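/- For $\alpha\in\mathbb{R}\setminus\mathbb{Q}$ let $k(\alpha)=\limsup_{p,q\to\infty}\frac{1}{|q(q\alpha-p)|}$, where $p,q\in\mathbb{Z}$ and $|p|,|q|\to\infty$, and let $$L=\{k(\alpha):\alpha\in\mathbb{R}\setminus\mathbb{Q},\ k(\alpha)<\infty\}$$ be the Lagrange spectrum. Let $$M=\left\{\frac{1}{\inf_{(x,y)\in\mathbb{Z}^2\setminus\{(0,0)\}}|q(x,y)|}<\infty:\ q(x,y)=ax^2+bxy+cy^2,\ a,b,c\in\mathbb{R},\ b^2-4ac=1\right\}$$ be the Markov spectrum. Write $[0;\gamma]$ for the value of the infinite continued fraction $[0;\gamma_0,\gamma_1,\gamma_2,\dots]$, and let $$X_4(\{14,41,24,42\})=\{[0;\gamma]:\ \gamma\in\{1,2,3,4\}^{\mathbb{N}}\text{ contains none of the words }14,\ 41,\ 24,\ 42\text{ as two consecutive terms}\}.$$ Then there is a set $K\subset\mathbb{R}$ of Hausdorff dimension $HD(K)<0.172825$ such that $$(M\setminus L)\cap(\sqrt{20},\sqrt{21})\subset X_4(\{14,41,24,42\})+K,$$ where $A+K=\{a+k:\ a\in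 A,\ k\in K\}$. -/

import Mathlib

open scoped Pointwise

/-- The (classical) Lagrange spectrum: the finite values of
`limsup 1 / |q (q α - p)|` as the integers `p, q` tend to infinity, that is as `|p|, |q| → ∞`
(the filter `cofinite ×ˢ cofinite` on pairs `(p, q)`), for `α` irrational.
The upper limit is taken in the extended reals, so it is never a junk value. -/
def lagrangeSpectrum : Set ℝ :=
  {m | ∃ α : ℝ, Irrational α ∧
    Filter.limsup (fun v : ℤ × ℤ => ((1 / |(v.2 : ℝ) * ((v.2 : ℝ) * α - (v.1 : ℝ))| : ℝ) : EReal))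
      (Filter.cofinite ×ˢ Filter.cofinite) = (m : EReal)}

/-- The infimum of `|a x ^ 2 + b x y + c y ^ 2|` over the nonzero integer vectors `(x, y)`
(a nonempty set of nonnegative reals). -/
noncomputable def binaryFormInf (a b c : ℝ) : ℝ :=
  ⨅ v : {v : ℤ × ℤ // v ≠ (0, 0)},
    |a * (v.1.1 : ℝ) ^ 2 + b * (v.1.1 : ℝ) * (v.1.2 : ℝ) + c * (v.1.2 : ℝ) ^ 2|

/-- The (classical) Markov spectrum: the finite values of `1 / inf |q(x, y)|` for real indefinite
binary quadratic forms `q(x, y) = a x ^ 2 + b x y + c y ^ 2` of discriminant one (a positive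
discriminant makes the form indefinite); finiteness means that the infimum is positive. -/
def markovSpectrum : Set ℝ :=
  {m | ∃ a b c : ℝ, b ^ 2 - 4 * a * c = 1 ∧ 0 < binaryFormInf a b c ∧
    m = 1 / binaryFormInf a b c}

/-- The infinite continued fraction `[0; γ 0, γ 1, γ 2, …]`. -/
noncomputable def contFracOfDigits (γ : ℕ → ℕ) : GenContFract ℝ :=
  ⟨0, Stream'.Seq.ofStream (fun n => (⟨1, (γ n : ℝ)⟩ : GenContFract.Pair ℝ))⟩

/-- `x = [0; γ 0, γ 1, γ 2, …]`: the convergents tend to `x`. -/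
def HasContFracValue (γ : ℕ → ℕ) (x : ℝ) : Prop :=
  Filter.Tendsto (fun n : ℕ => (contFracOfDigits γ).convs n) Filter.atTop (nhds x)

/-- The set of the numbers `[0; γ]`, where `γ` runs over the sequences in `{1, 2, 3, 4}` that
contain none of the two-letter words `14`, `41`, `24`, `42`. -/
def cantorX4 : Set ℝ :=
  {x | ∃ γ : ℕ → ℕ,
    (∀ i, γ i ∈ ({1, 2, 3, 4} : Set ℕ)) ∧
    (∀ i, (γ i, γ (i + 1)) ∉ ({(1, 4), (4, 1), (2, 4), (4, 2)} : Set (ℕ × ℕ))) ∧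
    HasContFracValue γ x}

/-- Continuant denominators, shifted by one: `0, 1, γ 0, γ 1 * γ 0 + 1, …`. -/
def contDen (γ : ℕ → ℕ) : ℕ → ℕ
  | 0 => 0
  | 1 => 1
  | n + 2 => γ n * contDen γ (n + 1) + contDen γ n

/-- Continuant numerators, shifted by one: `1, 0, 1, γ 1, …`. -/
def contNum (γ : ℕ → ℕ) : ℕ → ℕ
  | 0 => 1
  | 1 => 0
  | n + 2 => γ n * contNum γ (n + 1) + contNum γ n

/-- The Möbius map `x ↦ [0; γ 0, …, γ (n - 1) + x]`. -/
noncomputable def contMap (γ : ℕ → ℕ) (n : ℕ) (x : ℝ) : ℝ :=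
  (contNum γ (n + 1) + contNum γ n * x) / (contDen γ (n + 1) + contDen γ n * x)

/-- The finite continued fractions `[0; γ 0, …, γ (n - 1)]`, evaluated from the inside. -/
noncomputable def finCF : ℕ → (ℕ → ℕ) → ℝ
  | 0, _ => 0
  | n + 1, γ => 1 / ((γ 0 : ℝ) + finCF n (fun k => γ (k + 1)))

/-- The value of the infinite continued fraction `[0; γ 0, γ 1, …]`. -/
noncomputable def cfVal (γ : ℕ → ℕ) : ℝ :=
  Filter.limUnder Filter.atTop (fun n => finCF n γ)

theorem contDen_succ_pos {γ : ℕ → ℕ} (hγ : ∀ n, 1 ≤ γ n) (n : ℕ) : 1 ≤ contDen γ (n + 1) := by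
  induction n with
  | zero => simp [contDen]
  | succ n ih =>
    have := Nat.mul_le_mul (hγ n) ih
    simp only [contDen]; omega

theorem le_contDen_succ {γ : ℕ → ℕ} (hγ : ∀ n, 1 ≤ γ n) (n : ℕ) : n ≤ contDen γ (n + 1) := by
  induction n with
  | zero => simp
  | succ n ih =>
    rcases n with _ | n
    · have := hγ 0
      simp [contDen]; omega
    · have h1 := contDen_succ_pos hγ n
      have := Nat.mul_le_mul (hγ (n + 1)) ih
      have h3 : contDen γ (n + 1 + 1 + 1) = γ (n + 1) * contDen γ (n + 1 + 1) + contDen γ (n + 1) :=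
        rfl
      omega

theorem contDen_congr {γ δ : ℕ → ℕ} {n : ℕ} (h : ∀ k < n, γ k = δ k) :
    ∀ m ≤ n + 1, contDen γ m = contDen δ m := by
  intro m
  induction m using Nat.twoStepInduction with
  | zero => simp [contDen]
  | one => simp [contDen]
  | more m ih1 ih2 =>
    intro hm
    simp only [contDen]
    rw [ih1 (by omega), ih2 (by omega), h m (by omega)]

theorem contNum_congr {γ δ : ℕ → ℕ} {n : ℕ} (h : ∀ k < n, γ k = δ k) :
    ∀ m ≤ n + 1, contNum γ m = contNum δ m := by
  intro m
  induction m using Nat.twoStepInduction with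
  | zero => simp [contNum]
  | one => simp [contNum]
  | more m ih1 ih2 =>
    intro hm
    simp only [contNum]
    rw [ih1 (by omega), ih2 (by omega), h m (by omega)]

theorem contMap_congr {γ δ : ℕ → ℕ} {n : ℕ} (h : ∀ k < n, γ k = δ k) (x : ℝ) :
    contMap γ n x = contMap δ n x := by
  simp only [contMap, contDen_congr h (n + 1) le_rfl, contDen_congr h n (by omega),
    contNum_congr h (n + 1) le_rfl, contNum_congr h n (by omega)]

theorem cont_det (γ : ℕ → ℕ) (n : ℕ) :
    (contNum γ (n + 1) : ℤ) * contDen γ n - contNum γ n * contDen γ (n + 1) = (-1) ^ (n + 1) := by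
  induction n with
  | zero => simp [contNum, contDen]
  | succ n ih =>
    simp only [contNum, contDen]
    push_cast
    rw [pow_succ, ← ih]; ring

theorem cont_det_abs (γ : ℕ → ℕ) (n : ℕ) :
    |(contNum γ (n + 1) : ℝ) * contDen γ n - contNum γ n * contDen γ (n + 1)| = 1 := by
  have h := congrArg (fun z : ℤ => |(z : ℝ)|) (cont_det γ n)
  simpa using h

theorem contMap_denom_pos {γ : ℕ → ℕ} (hγ : ∀ n, 1 ≤ γ n) (n : ℕ) {x : ℝ} (hx : 0 ≤ x) :
    0 < (contDen γ (n + 1) : ℝ) + contDen γ n * x := by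
  have : (1 : ℝ) ≤ contDen γ (n + 1) := by exact_mod_cast contDen_succ_pos hγ n
  positivity

theorem eq_contMap {γ : ℕ → ℕ} (hγ : ∀ n, 1 ≤ γ n) {x : ℕ → ℝ} (hx : ∀ n, 0 ≤ x n) {N : ℕ}
    (h : ∀ n < N, x n = 1 / (γ n + x (n + 1))) : x 0 = contMap γ N (x N) := by
  induction N with
  | zero => simp [contMap, contNum, contDen]
  | succ N ih =>
    rw [ih (fun n hn => h n (by omega)), h N (by omega)]
    have h1 : (1 : ℝ) ≤ γ N := by exact_mod_cast hγ N
    have h2 := hx (N + 1)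
    have h3 : (γ N : ℝ) + x (N + 1) ≠ 0 := by positivity
    have h4 := (contMap_denom_pos hγ N (x := 1 / ((γ N : ℝ) + x (N + 1))) (by positivity)).ne'
    have h5 := (contMap_denom_pos hγ (N + 1) h2).ne'
    simp only [contMap, contNum, contDen] at h4 h5 ⊢
    push_cast at h5 ⊢
    rw [div_eq_div_iff h4 h5]
    field_simp
    ring

theorem contMap_sub_abs {γ : ℕ → ℕ} (hγ : ∀ n, 1 ≤ γ n) (n : ℕ) {x y : ℝ} (hx : 0 ≤ x)
    (hy : 0 ≤ y) : |contMap γ n x - contMap γ n y| =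
      |x - y| / (((contDen γ (n + 1) : ℝ) + contDen γ n * x) *
        ((contDen γ (n + 1) : ℝ) + contDen γ n * y)) := by
  have h1 := contMap_denom_pos hγ n hx
  have h2 := contMap_denom_pos hγ n hy
  have h3 : contMap γ n x - contMap γ n y =
      (((contNum γ (n + 1) : ℝ) * contDen γ n - contNum γ n * contDen γ (n + 1)) * (y - x)) /
      (((contDen γ (n + 1) : ℝ) + contDen γ n * x) *
        ((contDen γ (n + 1) : ℝ) + contDen γ n * y)) := by
    simp only [contMap]
    rw [div_sub_div _ _ h1.ne' h2.ne']
    congr 1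
    ring
  rw [h3, abs_div, abs_mul, cont_det_abs, one_mul, abs_sub_comm, abs_of_pos (mul_pos h1 h2)]

theorem contMap_dist_le {γ : ℕ → ℕ} (hγ : ∀ n, 1 ≤ γ n) (n : ℕ) {x y : ℝ} (hx : 0 ≤ x)
    (hx1 : x ≤ 1) (hy : 0 ≤ y) (hy1 : y ≤ 1) :
    |contMap γ n x - contMap γ n y| ≤ 1 / (contDen γ (n + 1) : ℝ) ^ 2 := by
  rw [contMap_sub_abs hγ n hx hy]
  have h0 : (1 : ℝ) ≤ contDen γ (n + 1) := by exact_mod_cast contDen_succ_pos hγ n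
  have h1 : (0 : ℝ) ≤ contDen γ n := by positivity
  have h2 : |x - y| ≤ 1 := by rw [abs_le]; constructor <;> linarith
  rw [sq]
  gcongr
  · nlinarith [mul_nonneg h1 hx]
  · nlinarith [mul_nonneg h1 hy]

theorem one_div_contDen_sq_le {γ : ℕ → ℕ} (hγ : ∀ n, 1 ≤ γ n) (n : ℕ) :
    1 / (contDen γ (n + 1) : ℝ) ^ 2 ≤ 2 / ((n : ℝ) + 1) := by
  have h0 : (1 : ℝ) ≤ contDen γ (n + 1) := by exact_mod_cast contDen_succ_pos hγ n
  have h1 : (n : ℝ) ≤ contDen γ (n + 1) := by exact_mod_cast le_contDen_succ hγ n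
  rw [div_le_div_iff₀ (by positivity) (by positivity)]
  nlinarith

theorem two_div_succ_tendsto : Filter.Tendsto (fun n : ℕ => 2 / ((n : ℝ) + 1)) Filter.atTop (nhds 0) :=
  Filter.Tendsto.div_atTop tendsto_const_nhds
    (Filter.tendsto_atTop_add_const_right _ _ tendsto_natCast_atTop_atTop)

theorem exists_two_div_lt {ε : ℝ} (hε : 0 < ε) : ∃ N : ℕ, ∀ n ≥ N, 2 / ((n : ℝ) + 1) < ε := by
  have := two_div_succ_tendsto.eventually (gt_mem_nhds hε)
  exact Filter.eventually_atTop.1 this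

theorem finCF_nonneg (n : ℕ) (γ : ℕ → ℕ) : 0 ≤ finCF n γ := by
  induction n generalizing γ with
  | zero => simp [finCF]
  | succ n ih => simp only [finCF]; have := ih (fun k => γ (k + 1)); positivity

theorem finCF_le_one {γ : ℕ → ℕ} (hγ : ∀ n, 1 ≤ γ n) (n : ℕ) : finCF n γ ≤ 1 := by
  cases n with
  | zero => simp [finCF]
  | succ n =>
    simp only [finCF]
    have := finCF_nonneg n (fun k => γ (k + 1))
    have h1 : (1 : ℝ) ≤ γ 0 := by exact_mod_cast hγ 0
    rw [div_le_one (by linarith)]; linarith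

theorem finCF_eq_contMap {γ : ℕ → ℕ} (hγ : ∀ n, 1 ≤ γ n) (N k : ℕ) :
    finCF (N + k) γ = contMap γ N (finCF k (fun j => γ (N + j))) := by
  have := eq_contMap hγ (x := fun n => finCF (N + k - n) (fun j => γ (n + j)))
    (fun n => finCF_nonneg _ _) (N := N) (by
      intro n hn
      obtain ⟨m, hm⟩ : ∃ m, N + k - n = m + 1 := ⟨N + k - n - 1, by omega⟩
      have hm' : N + k - (n + 1) = m := by omega
      simp only [hm, hm', finCF]
      simp [add_assoc, add_comm 1])
  simpa using this

theorem finCF_tendsto {γ : ℕ → ℕ} (hγ : ∀ n, 1 ≤ γ n) :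
    Filter.Tendsto (fun n => finCF n γ) Filter.atTop (nhds (cfVal γ)) := by
  have : CauchySeq (fun n => finCF n γ) := by
    rw [Metric.cauchySeq_iff]
    intro ε hε
    obtain ⟨N, hN⟩ := exists_two_div_lt hε
    refine ⟨N, fun m hm n hn => ?_⟩
    obtain ⟨m, rfl⟩ := Nat.exists_eq_add_of_le hm
    obtain ⟨n, rfl⟩ := Nat.exists_eq_add_of_le hn
    rw [Real.dist_eq, finCF_eq_contMap hγ, finCF_eq_contMap hγ]
    refine lt_of_le_of_lt (contMap_dist_le hγ N (finCF_nonneg _ _) ?_ (finCF_nonneg _ _) ?_)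
      (lt_of_le_of_lt (one_div_contDen_sq_le hγ N) (hN N le_rfl)) <;>
    exact finCF_le_one (fun n => hγ _) _
  exact this.tendsto_limUnder

theorem cfVal_nonneg {γ : ℕ → ℕ} (hγ : ∀ n, 1 ≤ γ n) : 0 ≤ cfVal γ :=
  ge_of_tendsto' (finCF_tendsto hγ) fun n => finCF_nonneg n γ

theorem cfVal_le_one {γ : ℕ → ℕ} (hγ : ∀ n, 1 ≤ γ n) : cfVal γ ≤ 1 :=
  le_of_tendsto' (finCF_tendsto hγ) fun n => finCF_le_one hγ n

theorem cfVal_step {γ : ℕ → ℕ} (hγ : ∀ n, 1 ≤ γ n) :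
    cfVal γ = 1 / (γ 0 + cfVal (fun k => γ (k + 1))) := by
  have h1 := (finCF_tendsto hγ).comp (Filter.tendsto_add_atTop_nat 1)
  have h2 := finCF_tendsto (γ := fun k => γ (k + 1)) (fun n => hγ _)
  have h0 : (1 : ℝ) ≤ γ 0 := by exact_mod_cast hγ 0
  have h3 := cfVal_nonneg (γ := fun k => γ (k + 1)) (fun n => hγ _)
  have h4 := (tendsto_const_nhds (x := (1 : ℝ))).div (h2.const_add (γ 0 : ℝ)) (by positivity)
  exact tendsto_nhds_unique h1 h4

theorem cfVal_pos {γ : ℕ → ℕ} (hγ : ∀ n, 1 ≤ γ n) : 0 < cfVal γ := by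
  rw [cfVal_step hγ]
  have h0 : (1 : ℝ) ≤ γ 0 := by exact_mod_cast hγ 0
  have h3 := cfVal_nonneg (γ := fun k => γ (k + 1)) (fun n => hγ _)
  positivity

theorem cfVal_lt_one {γ : ℕ → ℕ} (hγ : ∀ n, 1 ≤ γ n) : cfVal γ < 1 := by
  rw [cfVal_step hγ]
  have h0 : (1 : ℝ) ≤ γ 0 := by exact_mod_cast hγ 0
  have h3 := cfVal_pos (γ := fun k => γ (k + 1)) (fun n => hγ _)
  rw [div_lt_one (by linarith)]; linarith

theorem cfVal_eq_contMap {γ : ℕ → ℕ} (hγ : ∀ n, 1 ≤ γ n) (N : ℕ) :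
    cfVal γ = contMap γ N (cfVal (fun k => γ (N + k))) := by
  have := eq_contMap hγ (x := fun n => cfVal (fun k => γ (n + k)))
    (fun n => cfVal_nonneg (fun _ => hγ _)) (N := N) (by
      intro n _
      rw [cfVal_step (fun _ => hγ _)]
      simp [add_assoc, add_comm 1])
  simpa using this

theorem abs_sub_cfVal_le {γ : ℕ → ℕ} (hγ : ∀ n, 1 ≤ γ n) {x : ℕ → ℝ} (hx : ∀ n, 0 ≤ x n)
    (hx1 : ∀ n, x n ≤ 1) {N : ℕ} (h : ∀ n < N, x n = 1 / (γ n + x (n + 1))) :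
    |x 0 - cfVal γ| ≤ 1 / (contDen γ (N + 1) : ℝ) ^ 2 := by
  rw [eq_contMap hγ hx h, cfVal_eq_contMap hγ N]
  exact contMap_dist_le hγ N (hx N) (hx1 N) (cfVal_nonneg fun _ => hγ _) (cfVal_le_one fun _ => hγ _)

theorem eq_cfVal {γ : ℕ → ℕ} (hγ : ∀ n, 1 ≤ γ n) {x : ℕ → ℝ} (hx : ∀ n, 0 ≤ x n)
    (hx1 : ∀ n, x n ≤ 1) (h : ∀ n, x n = 1 / (γ n + x (n + 1))) : x 0 = cfVal γ := by
  have h1 : |x 0 - cfVal γ| ≤ 0 := ge_of_tendsto' two_div_succ_tendsto fun N =>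
    (abs_sub_cfVal_le hγ hx hx1 (fun n _ => h n)).trans (one_div_contDen_sq_le hγ N)
  exact sub_eq_zero.1 (abs_nonpos_iff.1 h1)

theorem abs_cfVal_sub_le_den {γ δ : ℕ → ℕ} (hγ : ∀ n, 1 ≤ γ n) (hδ : ∀ n, 1 ≤ δ n) {N : ℕ}
    (h : ∀ k < N, γ k = δ k) : |cfVal γ - cfVal δ| ≤ 1 / (contDen γ (N + 1) : ℝ) ^ 2 := by
  rw [cfVal_eq_contMap hγ N, cfVal_eq_contMap hδ N, ← contMap_congr h]
  exact contMap_dist_le hγ N (cfVal_nonneg fun _ => hγ _) (cfVal_le_one fun _ => hγ _)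
    (cfVal_nonneg fun _ => hδ _) (cfVal_le_one fun _ => hδ _)

theorem abs_cfVal_sub_le {γ δ : ℕ → ℕ} (hγ : ∀ n, 1 ≤ γ n) (hδ : ∀ n, 1 ≤ δ n) {N : ℕ}
    (h : ∀ k < N, γ k = δ k) : |cfVal γ - cfVal δ| ≤ 2 / ((N : ℝ) + 1) :=
  (abs_cfVal_sub_le_den hγ hδ h).trans (one_div_contDen_sq_le hγ N)

theorem hasContFracValue_cfVal {γ : ℕ → ℕ} (hγ : ∀ n, 1 ≤ γ n) :
    HasContFracValue γ (cfVal γ) := by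
  have h : ∀ n, (contFracOfDigits γ).convs n = finCF n γ := by
    intro n
    rw [GenContFract.convs_eq_convs']
    · suffices h : ∀ (n : ℕ) (γ : ℕ → ℕ), GenContFract.convs'Aux (Stream'.Seq.ofStream
          (fun n => (⟨1, (γ n : ℝ)⟩ : GenContFract.Pair ℝ))) n = finCF n γ by
        simp [GenContFract.convs', contFracOfDigits, h]
      intro n
      induction n with
      | zero => intro γ; simp [finCF]
      | succ n ih =>
        intro γ
        rw [GenContFract.convs'Aux_succ_some (p := ⟨1, (γ 0 : ℝ)⟩) rfl]
        simp only [finCF]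
        rw [← ih]
        rfl
    · intro gp m _ hm
      have : gp = ⟨1, (γ m : ℝ)⟩ := by
        have h2 : (contFracOfDigits γ).s.get? m = some ⟨1, (γ m : ℝ)⟩ := rfl
        rw [h2] at hm
        exact (Option.some.inj hm).symm
      subst this
      have := hγ m
      exact ⟨one_pos, by simp; omega⟩
  unfold HasContFracValue
  simp_rw [h]
  exact finCF_tendsto hγ

/-- The continued fraction of the digits of `a` to the right of position `i`. -/
noncomputable def rightCF (a : ℤ → ℕ) (i : ℤ) : ℝ := cfVal (fun k : ℕ => a (i + 1 + k))

/-- The continued fraction of the digits of `a` to the left of position `i`. -/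
noncomputable def leftCF (a : ℤ → ℕ) (i : ℤ) : ℝ := cfVal (fun k : ℕ => a (i - 1 - k))

/-- `[a i; a (i + 1), …] + [0; a (i - 1), …]`. -/
noncomputable def markovVal (a : ℤ → ℕ) (i : ℤ) : ℝ := a i + rightCF a i + leftCF a i

section biinfinite
variable {a b : ℤ → ℕ}

theorem rightCF_pos (ha : ∀ i, 1 ≤ a i) (i : ℤ) : 0 < rightCF a i := cfVal_pos fun _ => ha _
theorem leftCF_pos (ha : ∀ i, 1 ≤ a i) (i : ℤ) : 0 < leftCF a i := cfVal_pos fun _ => ha _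
theorem rightCF_lt_one (ha : ∀ i, 1 ≤ a i) (i : ℤ) : rightCF a i < 1 := cfVal_lt_one fun _ => ha _
theorem leftCF_lt_one (ha : ∀ i, 1 ≤ a i) (i : ℤ) : leftCF a i < 1 := cfVal_lt_one fun _ => ha _

theorem rightCF_step (ha : ∀ i, 1 ≤ a i) (i : ℤ) :
    rightCF a i = 1 / (a (i + 1) + rightCF a (i + 1)) := by
  have h : rightCF a (i + 1) = cfVal fun k : ℕ => a (i + 1 + ((k + 1 : ℕ) : ℤ)) := by
    unfold rightCF
    congr 1; ext k; congr 1; push_cast; ring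
  rw [h, rightCF, cfVal_step fun _ => ha _]
  simp

theorem leftCF_step (ha : ∀ i, 1 ≤ a i) (i : ℤ) :
    leftCF a i = 1 / (a (i - 1) + leftCF a (i - 1)) := by
  have h : leftCF a (i - 1) = cfVal fun k : ℕ => a (i - 1 - ((k + 1 : ℕ) : ℤ)) := by
    unfold leftCF
    congr 1; ext k; congr 1; push_cast; ring
  rw [h, leftCF, cfVal_step fun _ => ha _]
  simp

theorem rightCF_rev (a : ℤ → ℕ) (i : ℤ) : rightCF (fun j => a (-j)) i = leftCF a (-i) := by
  unfold rightCF leftCF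
  congr 1; ext k; exact congrArg a (by ring)

theorem leftCF_rev (a : ℤ → ℕ) (i : ℤ) : leftCF (fun j => a (-j)) i = rightCF a (-i) := by
  unfold rightCF leftCF
  congr 1; ext k; exact congrArg a (by ring)

theorem markovVal_rev (a : ℤ → ℕ) (i : ℤ) : markovVal (fun j => a (-j)) i = markovVal a (-i) := by
  simp only [markovVal, rightCF_rev, leftCF_rev]; ring

theorem abs_rightCF_sub_le (ha : ∀ i, 1 ≤ a i) (hb : ∀ i, 1 ≤ b i) (i : ℤ) {N : ℕ}
    (h : ∀ j, i < j → j ≤ i + N → a j = b j) : |rightCF a i - rightCF b i| ≤ 2 / ((N : ℝ) + 1) :=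
  abs_cfVal_sub_le (fun _ => ha _) (fun _ => hb _) fun k hk => h _ (by omega) (by omega)

theorem abs_leftCF_sub_le (ha : ∀ i, 1 ≤ a i) (hb : ∀ i, 1 ≤ b i) (i : ℤ) {N : ℕ}
    (h : ∀ j, j < i → i - N ≤ j → a j = b j) : |leftCF a i - leftCF b i| ≤ 2 / ((N : ℝ) + 1) :=
  abs_cfVal_sub_le (fun _ => ha _) (fun _ => hb _) fun k hk => h _ (by omega) (by omega)

theorem leftCF_congr {i : ℤ} (h : ∀ j, j < i → a j = b j) : leftCF a i = leftCF b i := by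
  unfold leftCF
  congr 1; ext k; exact h _ (by omega)

/-- Sequences that agree within distance `N` of `i` have close Markov values at `i`. -/
theorem abs_markovVal_sub_le (ha : ∀ i, 1 ≤ a i) (hb : ∀ i, 1 ≤ b i) (i : ℤ) {N : ℕ}
    (h : ∀ j, i - N ≤ j → j ≤ i + N → a j = b j) :
    |markovVal a i - markovVal b i| ≤ 4 / ((N : ℝ) + 1) := by
  have h1 := abs_rightCF_sub_le ha hb i (N := N) fun j h1 h2 => h j (by omega) h2
  have h2 := abs_leftCF_sub_le ha hb i (N := N) fun j h1 h2 => h j h2 (by omega)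
  have h3 : a i = b i := h i (by omega) (by omega)
  have h4 : (4 : ℝ) / ((N : ℝ) + 1) = 2 / ((N : ℝ) + 1) + 2 / ((N : ℝ) + 1) := by ring
  rw [h4]
  unfold markovVal
  rw [h3]
  rw [abs_le] at *
  constructor <;> linarith

end biinfinite

theorem contNum_succ_eq (γ : ℕ → ℕ) (n : ℕ) :
    contNum γ (n + 1) = contDen (fun k => γ (k + 1)) n := by
  induction n using Nat.twoStepInduction with
  | zero => simp [contNum, contDen]
  | one => simp [contNum, contDen]
  | more n ih1 ih2 =>
    rw [contDen, ← ih1, ← ih2, contNum]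

theorem finCF_eq_div {γ : ℕ → ℕ} (hγ : ∀ n, 1 ≤ γ n) (n : ℕ) :
    finCF n γ = contNum γ (n + 1) / contDen γ (n + 1) := by
  simpa [finCF, contMap] using finCF_eq_contMap hγ n 0

theorem convergent_cfVal {γ : ℕ → ℕ} (hγ : ∀ n, 1 ≤ γ n) (n : ℕ) :
    (((cfVal γ).convergent n : ℚ) : ℝ) = finCF n γ := by
  have hfl : ∀ γ : ℕ → ℕ, (∀ n, 1 ≤ γ n) → ⌊cfVal γ⌋ = 0 := fun γ hγ => by
    rw [Int.floor_eq_zero_iff]; exact ⟨cfVal_nonneg hγ, cfVal_lt_one hγ⟩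
  induction n generalizing γ with
  | zero => simp [finCF, hfl γ hγ]
  | succ n ih =>
    have ht : ∀ n, 1 ≤ (fun k => γ (k + 1)) n := fun n => hγ _
    have hinv : (cfVal γ)⁻¹ = ((γ 0 : ℤ) : ℝ) + cfVal (fun k => γ (k + 1)) := by
      rw [cfVal_step hγ]; simp
    have hfr : Int.fract (cfVal γ) = cfVal γ := by
      rw [Int.fract_eq_self]; exact ⟨cfVal_nonneg hγ, cfVal_lt_one hγ⟩
    have key : (cfVal γ)⁻¹.convergent n = (γ 0 : ℤ) + (cfVal (fun k => γ (k + 1))).convergent n := by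
      rw [hinv]
      cases n with
      | zero => rw [Real.convergent_zero, Real.convergent_zero, Int.floor_intCast_add]; simp
      | succ n =>
        rw [Real.convergent_succ, Real.convergent_succ, Int.floor_intCast_add, Int.fract_intCast_add]
        push_cast; ring
    rw [Real.convergent_succ, hfl γ hγ, hfr, key]
    push_cast
    rw [ih ht]
    simp [finCF]

/-- The approximation quality of the `n`th convergent. -/
theorem inv_convergent_error {γ : ℕ → ℕ} (hγ : ∀ n, 1 ≤ γ n) (n : ℕ) :
    1 / |(contDen γ (n + 1) : ℝ) * (contDen γ (n + 1) * cfVal γ - contNum γ (n + 1))| =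
      γ n + cfVal (fun k => γ (n + 1 + k)) + contDen γ n / contDen γ (n + 1) := by
  set x := cfVal (fun k => γ (n + k)) with hx
  have hxpos : 0 < x := cfVal_pos fun _ => hγ _
  have hstep : 1 / x = γ n + cfVal (fun k => γ (n + 1 + k)) := by
    rw [hx, cfVal_step fun _ => hγ _]
    simp [add_assoc, add_comm 1]
  have hQ : (0 : ℝ) < contDen γ (n + 1) := by exact_mod_cast contDen_succ_pos hγ n
  have hD := contMap_denom_pos hγ n hxpos.le
  have h1 : (contDen γ (n + 1) : ℝ) * cfVal γ - contNum γ (n + 1) =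
      -((contNum γ (n + 1) : ℝ) * contDen γ n - contNum γ n * contDen γ (n + 1)) * x /
        (contDen γ (n + 1) + contDen γ n * x) := by
    rw [cfVal_eq_contMap hγ n, ← hx, contMap]
    field_simp
    ring
  rw [h1, ← hstep, abs_mul, abs_div, abs_mul, abs_neg, cont_det_abs, abs_of_pos hQ, abs_of_pos hxpos,
    abs_of_pos hD]
  field_simp

theorem irrational_cfVal {γ : ℕ → ℕ} (hγ : ∀ n, 1 ≤ γ n) : Irrational (cfVal γ) := by
  rintro ⟨r, hr⟩
  set n := r.den with hn
  have hQ : (1 : ℝ) ≤ contDen γ (n + 1) := by exact_mod_cast contDen_succ_pos hγ n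
  have hQn : (n : ℝ) ≤ contDen γ (n + 1) := by exact_mod_cast le_contDen_succ hγ n
  have h := inv_convergent_error hγ n
  set z : ℝ := contDen γ (n + 1) * cfVal γ - contNum γ (n + 1) with hz
  have hpos : (1 : ℝ) < γ n + cfVal (fun k => γ (n + 1 + k)) + contDen γ n / contDen γ (n + 1) := by
    have h1 : (1 : ℝ) ≤ γ n := by exact_mod_cast hγ n
    have h2 : 0 < cfVal (fun k => γ (n + 1 + k)) := cfVal_pos fun _ => hγ _
    have h3 : (0 : ℝ) ≤ contDen γ n / contDen γ (n + 1) := by positivity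
    linarith
  rw [← h] at hpos
  have hz0 : z ≠ 0 := by rintro h0; rw [h0] at hpos; norm_num at hpos
  have hzpos : 0 < |z| := abs_pos.2 hz0
  have hd : (0 : ℝ) < n := by exact_mod_cast r.pos
  have hint : (n : ℝ) * z = ((contDen γ (n + 1) * r.num - n * contNum γ (n + 1) : ℤ) : ℝ) := by
    have : (n : ℝ) * (r : ℝ) = r.num := by
      have := Rat.den_mul_eq_num r
      exact_mod_cast this
    rw [hz, ← hr]; push_cast; rw [← this]; ring
  have h1 : (1 : ℝ) ≤ n * |z| := by
    have hne : (contDen γ (n + 1) * r.num - n * contNum γ (n + 1) : ℤ) ≠ 0 := by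
      intro h0; rw [h0] at hint; simp at hint; rcases hint with h | h
      · exact hd.ne' (by exact_mod_cast h)
      · exact hz0 h
    have := Int.one_le_abs hne
    rw [← abs_of_pos hd, ← abs_mul, hint]
    exact_mod_cast this
  have hbig : (1 : ℝ) ≤ |(contDen γ (n + 1) : ℝ) * z| := by
    rw [abs_mul, abs_of_pos (by linarith)]
    nlinarith
  have : 1 / |(contDen γ (n + 1) : ℝ) * z| ≤ 1 := by
    rw [div_le_one (by linarith)]; exact hbig
  linarith

/-- The ratio of successive continuants is close to the left continued fraction. -/
theorem abs_leftCF_sub_contDen_le {a : ℤ → ℕ} (ha : ∀ i, 1 ≤ a i) (n : ℕ) :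
    |(contDen (fun k => a k) n : ℝ) / contDen (fun k => a k) (n + 1) - leftCF a n| ≤
      2 / ((n : ℝ) + 1) := by
  set γ : ℕ → ℕ := fun k => a k with hγdef
  have hγ : ∀ n, 1 ≤ γ n := fun n => ha _
  have hQ : ∀ n, (0 : ℝ) < contDen γ (n + 1) := fun n => by exact_mod_cast contDen_succ_pos hγ n
  have hle : ∀ n, (contDen γ n : ℝ) / contDen γ (n + 1) ≤ 1 := by
    intro n
    rw [div_le_one (hQ n)]
    have : contDen γ n ≤ contDen γ (n + 1) := by
      rcases n with _ | n
      · simp [contDen]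
      · have := Nat.mul_le_mul (hγ n) (le_refl (contDen γ (n + 1)))
        simp only [contDen]; omega
    exact_mod_cast this
  have := abs_sub_cfVal_le (γ := fun k : ℕ => a (n - 1 - k)) (fun _ => ha _)
    (x := fun k => (contDen γ (n - k) : ℝ) / contDen γ (n - k + 1))
    (fun k => by positivity) (fun k => hle _) (N := n) (by
      intro k hk
      obtain ⟨m, hm⟩ : ∃ m, n - k = m + 1 := ⟨n - k - 1, by omega⟩
      have hm' : n - (k + 1) = m := by omega
      have hidx : a ((n : ℤ) - 1 - k) = γ m := by rw [hγdef]; congr 1; omega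
      have hp := hQ m
      simp only [hm, hm', hidx, contDen]
      push_cast
      field_simp)
  refine le_trans ?_ (this.trans (one_div_contDen_sq_le (fun _ => ha _) n))
  simp [leftCF]

theorem abs_markovVal_sub_error_le {a : ℤ → ℕ} (ha : ∀ i, 1 ≤ a i) (n : ℕ) :
    |1 / |(contDen (fun k => a k) (n + 1) : ℝ) *
      (contDen (fun k => a k) (n + 1) * cfVal (fun k => a k) - contNum (fun k => a k) (n + 1))| -
      markovVal a n| ≤ 2 / ((n : ℝ) + 1) := by
  rw [inv_convergent_error fun _ => ha _]
  have h := abs_leftCF_sub_contDen_le ha n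
  have h1 : rightCF a n = cfVal (fun k : ℕ => a ((n + 1 + k : ℕ) : ℤ)) := by
    unfold rightCF; congr 1
  rw [markovVal, h1]
  convert h using 2
  ring

/-- A number above `2` that is the upper limit of the Markov values of a bounded sequence is in the
Lagrange spectrum. -/
theorem mem_lagrangeSpectrum_of_markovVal {a : ℤ → ℕ} (ha : ∀ i, 1 ≤ a i) (ha4 : ∀ i, a i ≤ 4)
    {m : ℝ} (hm : 2 < m) (hub : ∀ ε > 0, ∃ N : ℕ, ∀ n : ℕ, N ≤ n → markovVal a n ≤ m + ε)
    (hlb : ∀ ε > 0, ∀ N : ℕ, ∃ n : ℕ, N ≤ n ∧ m - ε ≤ markovVal a n) :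
    m ∈ lagrangeSpectrum := by
  set γ : ℕ → ℕ := fun k => a k with hγdef
  have hγ : ∀ n, 1 ≤ γ n := fun n => ha _
  set α := cfVal γ with hα
  have herr := abs_markovVal_sub_error_le ha
  set V : ℕ → ℝ := fun n => 1 / |(contDen γ (n + 1) : ℝ) *
      (contDen γ (n + 1) * α - contNum γ (n + 1))| with hV
  have hVle : ∀ n, V n ≤ 6 := by
    intro n
    rw [hV]; simp only
    rw [hα, inv_convergent_error hγ n]
    have h1 : (γ n : ℝ) ≤ 4 := by exact_mod_cast ha4 n
    have h2 : cfVal (fun k => γ (n + 1 + k)) ≤ 1 := cfVal_le_one fun _ => hγ _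
    have h3 : (contDen γ n : ℝ) / contDen γ (n + 1) ≤ 1 := by
      have h4 := abs_le.1 (abs_leftCF_sub_contDen_le ha n)
      rw [div_le_one (by exact_mod_cast contDen_succ_pos hγ n)]
      have : contDen γ n ≤ contDen γ (n + 1) := by
        rcases n with _ | n
        · simp [contDen]
        · have := Nat.mul_le_mul (hγ n) (le_refl (contDen γ (n + 1)))
          simp only [contDen]; omega
      exact_mod_cast this
    linarith
  refine ⟨α, irrational_cfVal hγ, le_antisymm ?_ ?_⟩
  · rw [← EReal.le_of_forall_lt_iff_le]
    intro c hc
    have hc : m < c := by exact_mod_cast hc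
    apply Filter.limsup_le_of_le (by isBoundedDefault)
    obtain ⟨N₁, hN₁⟩ := hub ((c - m) / 2) (by linarith)
    obtain ⟨N₂, hN₂⟩ := exists_two_div_lt (ε := (c - m) / 2) (by linarith)
    have hVN : ∀ n, N₁ + N₂ ≤ n → V n ≤ c := by
      intro n hn
      have h1 := hN₁ n (by omega)
      have h2 := hN₂ n (by omega)
      have h3 := (abs_le.1 (herr n)).2
      simp only [hV]
      linarith
    set A : Set ℤ := {0} ∪ ((fun n : ℕ => (contDen γ (n + 1) : ℤ)) '' Set.Iio (N₁ + N₂) ∪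
      (fun n : ℕ => -(contDen γ (n + 1) : ℤ)) '' Set.Iio (N₁ + N₂)) with hA
    have hAfin : A.Finite := (Set.finite_singleton _).union
      (((Set.finite_Iio _).image _).union ((Set.finite_Iio _).image _))
    have hmem : (Set.univ ×ˢ Aᶜ : Set (ℤ × ℤ)) ∈ Filter.cofinite ×ˢ Filter.cofinite :=
      Filter.prod_mem_prod Filter.univ_mem hAfin.compl_mem_cofinite
    filter_upwards [hmem]
    rintro ⟨p, q⟩ ⟨-, hq⟩
    simp only
    norm_cast
    by_contra! hlt
    have hq0 : q ≠ 0 := fun h => hq (Or.inl h)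
    have hqR : (q : ℝ) ≠ 0 := by exact_mod_cast hq0
    have hq2 : (0 : ℝ) < (q : ℝ) ^ 2 := by positivity
    have hEpos : 0 < |(q : ℝ) * (q * α - p)| := by
      by_contra! h
      have h0 : |(q : ℝ) * (q * α - p)| = 0 := le_antisymm h (abs_nonneg _)
      rw [h0] at hlt; norm_num at hlt; linarith
    have hE2 : |(q : ℝ) * (q * α - p)| < 1 / 2 := by
      rw [lt_div_iff₀ hEpos] at hlt
      nlinarith
    have hfac : |(q : ℝ) * (q * α - p)| = (q : ℝ) ^ 2 * |α - ((p / q : ℚ) : ℝ)| := by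
      have : (q : ℝ) * (q * α - p) = (q : ℝ) ^ 2 * (α - ((p / q : ℚ) : ℝ)) := by
        push_cast; field_simp
      rw [this, abs_mul, abs_of_pos hq2]
    obtain ⟨n, hn⟩ : ∃ n, ((p / q : ℚ)) = α.convergent n := by
      apply Real.exists_rat_eq_convergent
      have hden : ((p / q : ℚ).den : ℝ) ^ 2 ≤ (q : ℝ) ^ 2 := by
        have h1 : ((p / q : ℚ).den : ℤ) ∣ q := by
          have := Rat.den_dvd p q
          rwa [Rat.divInt_eq_div] at this
        have h2 := Int.natAbs_dvd_natAbs.2 h1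
        have h3 := Nat.le_of_dvd (by omega) h2
        rw [← sq_abs (q : ℝ)]
        have h4 : ((p / q : ℚ).den : ℝ) ≤ |(q : ℝ)| := by
          have : (((p / q : ℚ).den : ℤ)) ≤ |q| := by
            rw [Int.natAbs_natCast] at h3
            rw [Int.abs_eq_natAbs]
            exact_mod_cast h3
          exact_mod_cast this
        gcongr
      have hdpos : (0 : ℝ) < ((p / q : ℚ).den : ℝ) := by exact_mod_cast (p / q : ℚ).pos
      rw [lt_div_iff₀ (by positivity)]
      rw [hfac] at hE2
      nlinarith [mul_le_mul_of_nonneg_right hden (abs_nonneg (α - ((p / q : ℚ) : ℝ)))]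
    have hn' : (p : ℝ) / q = contNum γ (n + 1) / contDen γ (n + 1) := by
      rw [← finCF_eq_div hγ, ← convergent_cfVal hγ, ← hα, ← hn]; push_cast; rfl
    have hQpos : (0 : ℝ) < contDen γ (n + 1) := by exact_mod_cast contDen_succ_pos hγ n
    rw [div_eq_div_iff hqR hQpos.ne'] at hn'
    have hn'' : p * (contDen γ (n + 1) : ℤ) = contNum γ (n + 1) * q := by exact_mod_cast hn'
    have hcop : IsCoprime (contDen γ (n + 1) : ℤ) (contNum γ (n + 1)) := by
      have hd := cont_det γ n
      rcases neg_one_pow_eq_or ℤ (n + 1) with h | h <;> rw [h] at hd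
      · exact ⟨-contNum γ n, contDen γ n, by linarith⟩
      · exact ⟨contNum γ n, -contDen γ n, by linarith⟩
    obtain ⟨k, hk⟩ : (contDen γ (n + 1) : ℤ) ∣ q :=
      hcop.dvd_of_dvd_mul_left ⟨p, by rw [← hn'']; ring⟩
    have hQ0 : (contDen γ (n + 1) : ℤ) ≠ 0 := by exact_mod_cast hQpos.ne'
    have hpk : p = contNum γ (n + 1) * k := by
      apply mul_right_cancel₀ hQ0
      rw [hn'', hk]; ring
    have hk0 : k ≠ 0 := by rintro rfl; simp at hk; exact hq0 hk
    have hFV : 1 / |(q : ℝ) * (q * α - p)| = V n / (k : ℝ) ^ 2 := by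
      have : (q : ℝ) * (q * α - p) = (k : ℝ) ^ 2 * ((contDen γ (n + 1) : ℝ) *
          (contDen γ (n + 1) * α - contNum γ (n + 1))) := by
        rw [hpk, hk]; push_cast; ring
      rw [this, abs_mul, abs_of_nonneg (sq_nonneg (k : ℝ))]
      simp only [hV]
      have : (k : ℝ) ≠ 0 := by exact_mod_cast hk0
      field_simp
    rw [hFV] at hlt
    by_cases hk1 : k = 1 ∨ k = -1
    · have hksq : (k : ℝ) ^ 2 = 1 := by rcases hk1 with rfl | rfl <;> norm_num
      rw [hksq, div_one] at hlt
      have hnN : N₁ + N₂ ≤ n := by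
        by_contra! hcon
        apply hq
        right
        rcases hk1 with rfl | rfl
        · left; exact ⟨n, hcon, by simp [hk]⟩
        · right; exact ⟨n, hcon, by simp [hk]⟩
      linarith [hVN n hnN]
    · have hkabs : (2 : ℤ) ≤ |k| := by
        rw [le_abs]; omega
      have hk4 : (4 : ℝ) ≤ (k : ℝ) ^ 2 := by
        rw [← sq_abs]
        have : (2 : ℝ) ≤ |(k : ℝ)| := by exact_mod_cast hkabs
        nlinarith
      rw [lt_div_iff₀ (by linarith)] at hlt
      nlinarith [hVle n]
  · refine le_of_forall_lt_imp_le_of_dense fun c hc => ?_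
    obtain ⟨c', hc1, hc2⟩ := EReal.lt_iff_exists_real_btwn.1 hc
    have hc2 : c' < m := by exact_mod_cast hc2
    refine hc1.le.trans (Filter.le_limsup_of_frequently_le ?_ (by isBoundedDefault))
    have htend : Filter.Tendsto (fun n : ℕ => ((contNum γ (n + 1) : ℤ), (contDen γ (n + 1) : ℤ)))
        Filter.atTop (Filter.cofinite ×ˢ Filter.cofinite) := by
      have hcof : ∀ f : ℕ → ℕ, (∀ n, n ≤ f (n + 1) + 1) →
          Filter.Tendsto (fun n => (f n : ℤ)) Filter.atTop Filter.cofinite := by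
        intro f hf
        have : Filter.Tendsto (fun n => (f n : ℤ)) Filter.atTop Filter.atTop := by
          apply tendsto_natCast_atTop_atTop.comp
          rw [Filter.tendsto_atTop_atTop]
          intro b
          refine ⟨b + 2, fun n hn => ?_⟩
          obtain ⟨k, rfl⟩ : ∃ k, n = k + 1 := ⟨n - 1, by omega⟩
          have := hf k
          omega
        exact this.mono_right Filter.atTop_le_cofinite
      apply Filter.Tendsto.prodMk
      · apply hcof
        intro n
        rw [contNum_succ_eq]
        have := le_contDen_succ (γ := fun k => γ (k + 1)) (fun _ => hγ _) n
        omega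
      · apply hcof
        intro n
        have := le_contDen_succ hγ (n + 1)
        omega
    apply htend.frequently
    rw [Filter.frequently_atTop]
    intro N
    obtain ⟨N₂, hN₂⟩ := exists_two_div_lt (ε := (m - c') / 2) (by linarith)
    obtain ⟨n, hn, hn2⟩ := hlb ((m - c') / 2) (by linarith) (N + N₂)
    refine ⟨n, by omega, ?_⟩
    have h2 := hN₂ n (by omega)
    have h3 := (abs_le.1 (herr n)).1
    have : c' ≤ V n := by simp only [hV]; linarith
    exact_mod_cast this

theorem binaryFormInf_le (a b c : ℝ) {x y : ℤ} (h : (x, y) ≠ (0, 0)) :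
    binaryFormInf a b c ≤ |a * (x : ℝ) ^ 2 + b * (x : ℝ) * (y : ℝ) + c * (y : ℝ) ^ 2| :=
  ciInf_le (f := fun v : {v : ℤ × ℤ // v ≠ (0, 0)} =>
    |a * (v.1.1 : ℝ) ^ 2 + b * (v.1.1 : ℝ) * (v.1.2 : ℝ) + c * (v.1.2 : ℝ) ^ 2|)
    ⟨0, by rintro _ ⟨v, rfl⟩; exact abs_nonneg _⟩ ⟨(x, y), h⟩

/-- The value of a form is nearly minimal at some primitive vector. -/
theorem exists_primitive_lt {a b c δ : ℝ} (hδ : 0 < δ) :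
    ∃ x y : ℤ, IsCoprime x y ∧
      |a * (x : ℝ) ^ 2 + b * (x : ℝ) * (y : ℝ) + c * (y : ℝ) ^ 2| < binaryFormInf a b c + δ := by
  have : Nonempty {v : ℤ × ℤ // v ≠ (0, 0)} := ⟨⟨(1, 0), by simp⟩⟩
  obtain ⟨⟨⟨x, y⟩, hv⟩, hlt⟩ := exists_lt_of_ciInf_lt (f := fun v : {v : ℤ × ℤ // v ≠ (0, 0)} =>
    |a * (v.1.1 : ℝ) ^ 2 + b * (v.1.1 : ℝ) * (v.1.2 : ℝ) + c * (v.1.2 : ℝ) ^ 2|)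
    (lt_add_of_pos_right (binaryFormInf a b c) hδ)
  simp only at hlt
  have hg : Int.gcd x y ≠ 0 := by
    rw [Ne, Int.gcd_eq_zero_iff]
    rintro ⟨rfl, rfl⟩; exact hv rfl
  obtain ⟨x', y', hc, hx, hy⟩ := Int.exists_gcd_one (Nat.pos_of_ne_zero hg)
  refine ⟨x', y', Int.isCoprime_iff_gcd_eq_one.2 hc, lt_of_le_of_lt ?_ hlt⟩
  have hg1 : (1 : ℝ) ≤ (Int.gcd x y : ℝ) ^ 2 := by
    have : (1 : ℝ) ≤ Int.gcd x y := by exact_mod_cast Nat.pos_of_ne_zero hg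
    nlinarith
  set g := Int.gcd x y
  have : a * (x : ℝ) ^ 2 + b * (x : ℝ) * (y : ℝ) + c * (y : ℝ) ^ 2 =
      (g : ℝ) ^ 2 * (a * (x' : ℝ) ^ 2 + b * (x' : ℝ) * (y' : ℝ) + c * (y' : ℝ) ^ 2) := by
    rw [hx, hy]; push_cast; ring
  rw [this, abs_mul, abs_of_nonneg (sq_nonneg (g : ℝ))]
  exact le_mul_of_one_le_left (abs_nonneg _) hg1

theorem exists_normalized_roots {a b c δ : ℝ} (hdisc : b ^ 2 - 4 * a * c = 1)
    (hpos : 0 < binaryFormInf a b c) (hδ : 0 < δ) :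
    ∃ θ y : ℝ, 0 ≤ y ∧ y ≤ 1 ∧ 1 / (binaryFormInf a b c + δ) ≤ θ + y ∧
      θ + y ≤ 1 / binaryFormInf a b c ∧
      ∀ u v : ℤ, (u, v) ≠ (0, 0) →
        binaryFormInf a b c / (binaryFormInf a b c + δ) ≤ |(u - v * θ) * (u + v * y)| := by
  set μ := binaryFormInf a b c with hμ
  obtain ⟨x, y, ⟨s, t, hst⟩, hlt⟩ := exists_primitive_lt (a := a) (b := b) (c := c) hδ
  rw [← hμ] at hlt
  set A := a * (x : ℝ) ^ 2 + b * (x : ℝ) * (y : ℝ) + c * (y : ℝ) ^ 2 with hA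
  set B := 2 * a * x * (-t) + b * (x * s - t * y) + 2 * c * y * s with hB
  set C := a * (t : ℝ) ^ 2 - b * t * s + c * s ^ 2 with hC
  have hstR : (s : ℝ) * x + t * y = 1 := by exact_mod_cast hst
  have hdisc' : B ^ 2 - 4 * A * C = 1 := by
    have : B ^ 2 - 4 * A * C = (b ^ 2 - 4 * a * c) * ((s : ℝ) * x + t * y) ^ 2 := by
      simp only [hA, hB, hC]; ring
    rw [this, hdisc, hstR]; norm_num
  have hF : ∀ X Y : ℤ, (X, Y) ≠ (0, 0) →
      μ ≤ |A * (X : ℝ) ^ 2 + B * X * Y + C * (Y : ℝ) ^ 2| := by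
    intro X Y hXY
    have hne : (x * X - t * Y, y * X + s * Y) ≠ ((0, 0) : ℤ × ℤ) := by
      intro h
      rw [Prod.mk.injEq] at h
      apply hXY
      rw [Prod.mk.injEq]
      constructor
      · linear_combination s * h.1 + t * h.2 - X * hst
      · linear_combination x * h.2 - y * h.1 - Y * hst
    have := binaryFormInf_le a b c hne
    rw [← hμ] at this
    convert this using 2
    simp only [hA, hB, hC]; push_cast; ring
  have hApos : μ ≤ |A| := by
    have hne : ((1 : ℤ), (0 : ℤ)) ≠ (0, 0) := by simp
    simpa using hF 1 0 hne
  have hA0 : A ≠ 0 := abs_pos.1 (lt_of_lt_of_le hpos hApos)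
  have hAabs : 0 < |A| := abs_pos.2 hA0
  have key : ∃ p q : ℝ, p - q = 1 / |A| ∧ ∀ X Y : ℝ,
      |A * X ^ 2 + B * X * Y + C * Y ^ 2| = |A| * |(X - p * Y) * (X - q * Y)| := by
    have hfac : ∀ X Y : ℝ, A * X ^ 2 + B * X * Y + C * Y ^ 2 =
        A * ((X - (-B + 1) / (2 * A) * Y) * (X - (-B - 1) / (2 * A) * Y)) := by
      intro X Y
      have hCe : C = (B ^ 2 - 1) / (4 * A) := by field_simp; linarith
      rw [hCe]; field_simp; ring
    rcases lt_or_gt_of_ne hA0 with h | h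
    · refine ⟨(-B - 1) / (2 * A), (-B + 1) / (2 * A), ?_, fun X Y => ?_⟩
      · rw [abs_of_neg h]; field_simp; ring
      · rw [hfac, abs_mul, mul_comm (X - (-B - 1) / (2 * A) * Y)]
    · refine ⟨(-B + 1) / (2 * A), (-B - 1) / (2 * A), ?_, fun X Y => ?_⟩
      · rw [abs_of_pos h]; field_simp; ring
      · rw [hfac, abs_mul]
  obtain ⟨p, q, hpq, hfac⟩ := key
  refine ⟨p - ⌈q⌉, ⌈q⌉ - q, ?_, ?_, ?_, ?_, ?_⟩
  · linarith [Int.le_ceil q]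
  · linarith [Int.ceil_lt_add_one q]
  · have : p - ⌈q⌉ + (⌈q⌉ - q) = 1 / |A| := by rw [← hpq]; ring
    rw [this]
    exact one_div_le_one_div_of_le hAabs hlt.le
  · have : p - ⌈q⌉ + (⌈q⌉ - q) = 1 / |A| := by rw [← hpq]; ring
    rw [this]
    exact one_div_le_one_div_of_le hpos hApos
  · intro u v huv
    have hne : (u + ⌈q⌉ * v, v) ≠ ((0, 0) : ℤ × ℤ) := by
      intro h
      rw [Prod.mk.injEq] at h
      apply huv
      rw [Prod.mk.injEq]
      refine ⟨?_, h.2⟩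
      have := h.1; rw [h.2] at this; simpa using this
    have h1 := hF _ _ hne
    rw [hfac] at h1
    have h2 : ((u : ℝ) - v * (p - ⌈q⌉)) * (u + v * (⌈q⌉ - q)) =
        (((u + ⌈q⌉ * v : ℤ) : ℝ) - p * v) * (((u + ⌈q⌉ * v : ℤ) : ℝ) - q * v) := by
      push_cast; ring
    rw [h2, div_le_iff₀ (by linarith)]
    refine h1.trans ?_
    rw [mul_comm]
    gcongr

/-- The pair `x, -y` of roots of a form of Markov value at most `m`. -/
def RootPair (m x y : ℝ) : Prop :=
  ∀ u v : ℤ, (u, v) ≠ (0, 0) → (x + y) / m ≤ |(u - v * x) * (u + v * y)|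

theorem exists_rootPair {m : ℝ} (hm : m ∈ markovSpectrum) :
    0 < m ∧ ∃ x y : ℝ, 0 ≤ y ∧ y ≤ 1 ∧ x + y = m ∧ RootPair m x y := by
  obtain ⟨a, b, c, hdisc, hpos, rfl⟩ := hm
  refine ⟨by positivity, ?_⟩
  set μ := binaryFormInf a b c
  have hδ : ∀ k : ℕ, (0 : ℝ) < 1 / ((k : ℝ) + 1) := fun k => by positivity
  choose θ y hy0 hy1 hlo hhi hF using fun k : ℕ => exists_normalized_roots hdisc hpos (hδ k)
  have hcomp : IsCompact (Set.Icc (-1 : ℝ) (1 / μ) ×ˢ Set.Icc (0 : ℝ) 1) :=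
    isCompact_Icc.prod isCompact_Icc
  obtain ⟨⟨x₀, y₀⟩, hmem, φ, hφ, hlim⟩ := hcomp.tendsto_subseq (x := fun k => (θ k, y k)) (by
    intro k
    have h1 : 0 < 1 / (μ + 1 / ((k : ℝ) + 1)) := by have := hδ k; positivity
    have h2 := hy0 k
    have h3 := hy1 k
    have h4 := hlo k
    have h5 := hhi k
    exact ⟨⟨by simp only; linarith, by simp only; linarith⟩, ⟨h2, h3⟩⟩)
  have hx := (continuous_fst.tendsto _).comp hlim
  have hy := (continuous_snd.tendsto _).comp hlim
  have hd : Filter.Tendsto (fun k => μ + 1 / ((φ k : ℝ) + 1)) Filter.atTop (nhds (μ + 0)) :=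
    (tendsto_one_div_add_atTop_nhds_zero_nat.comp hφ.tendsto_atTop).const_add μ
  rw [add_zero] at hd
  have hsum : x₀ + y₀ = 1 / μ := by
    apply le_antisymm
    · exact le_of_tendsto' (hx.add hy) fun k => hhi (φ k)
    · exact le_of_tendsto_of_tendsto' ((tendsto_const_nhds (x := (1 : ℝ))).div hd hpos.ne')
        (hx.add hy) fun k => hlo (φ k)
  refine ⟨x₀, y₀, hmem.2.1, hmem.2.2, hsum, fun u v huv => ?_⟩
  have h1 : (x₀ + y₀) / (1 / μ) = μ / μ := by rw [hsum]; field_simp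
  rw [h1]
  refine le_of_tendsto_of_tendsto' ((tendsto_const_nhds (x := μ)).div hd hpos.ne') ?_
    fun k => hF (φ k) u v huv
  exact (((hx.const_mul (v : ℝ)).const_sub (u : ℝ)).mul ((hy.const_mul (v : ℝ)).const_add (u : ℝ))).abs

namespace RootPair
variable {m x y : ℝ}

theorem ne_left (h : RootPair m x y) (hm : 0 < m) (hxy : 0 < x + y) {u v : ℤ}
    (huv : (u, v) ≠ (0, 0)) : (u : ℝ) - v * x ≠ 0 := by
  intro h0
  have := h u v huv
  rw [h0] at this
  simp only [zero_mul, abs_zero] at this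
  have : 0 < (x + y) / m := by positivity
  linarith

theorem ne_right (h : RootPair m x y) (hm : 0 < m) (hxy : 0 < x + y) {u v : ℤ}
    (huv : (u, v) ≠ (0, 0)) : (u : ℝ) + v * y ≠ 0 := by
  intro h0
  have := h u v huv
  rw [h0] at this
  simp only [mul_zero, abs_zero] at this
  have : 0 < (x + y) / m := by positivity
  linarith

theorem add_le (h : RootPair m x y) (hm : 0 < m) : x + y ≤ m := by
  have hne : ((1 : ℤ), (0 : ℤ)) ≠ (0, 0) := by simp
  have := h 1 0 hne
  simpa [div_le_one hm] using this

theorem step (h : RootPair m x y) (d : ℤ) (hx : 0 < x - d) (hy : 0 < d + y) :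
    RootPair m (1 / (x - d)) (1 / (d + y)) := by
  intro u v huv
  have hne : (v + u * d, u) ≠ ((0, 0) : ℤ × ℤ) := by
    intro h
    rw [Prod.mk.injEq] at h
    apply huv
    rw [Prod.mk.injEq]
    refine ⟨h.2, ?_⟩
    have := h.1; rw [h.2] at this; simpa using this
  have h1 := h _ _ hne
  have hp : 0 < (x - d) * (d + y) := mul_pos hx hy
  have e1 : (1 / (x - d) + 1 / (d + y)) / m = (x + y) / m / ((x - d) * (d + y)) := by
    field_simp; ring
  have e2 : ((u : ℝ) - v * (1 / (x - d))) * (u + v * (1 / (d + y))) =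
      -((((v + u * d : ℤ) : ℝ) - u * x) * (((v + u * d : ℤ) : ℝ) + u * y)) / ((x - d) * (d + y)) := by
    push_cast; field_simp; ring
  rw [e1, e2, abs_div, abs_neg, abs_of_pos hp]
  gcongr

theorem swap (h : RootPair m x y) (hx : 0 < x) (hy : 0 < y) : RootPair m (1 / y) (1 / x) := by
  intro u v huv
  have hne : (v, -u) ≠ ((0, 0) : ℤ × ℤ) := by
    intro h
    rw [Prod.mk.injEq] at h
    apply huv
    rw [Prod.mk.injEq]
    exact ⟨by simpa using h.2, h.1⟩
  have h1 := h _ _ hne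
  have e1 : (1 / y + 1 / x) / m = (x + y) / m / (x * y) := by field_simp
  have e2 : ((u : ℝ) - v * (1 / y)) * (u + v * (1 / x)) =
      -(((v : ℝ) - ((-u : ℤ) : ℝ) * x) * ((v : ℝ) + ((-u : ℤ) : ℝ) * y)) / (x * y) := by
    push_cast; field_simp; ring
  rw [e1, e2, abs_div, abs_neg, abs_of_pos (mul_pos hx hy)]
  gcongr

theorem exists_digits (h : RootPair m x y) (hm : 0 < m) (hx : 1 < x) (hy : 0 < y) (hy1 : y < 1) :
    ∃ (d : ℕ → ℕ) (xs ys : ℕ → ℝ), xs 0 = x ∧ ys 0 = y ∧ ∀ n, 1 ≤ d n ∧ 1 < xs n ∧ 0 < ys n ∧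
      ys n < 1 ∧ xs n + ys n ≤ m ∧ xs n = d n + 1 / xs (n + 1) ∧ ys (n + 1) = 1 / (d n + ys n) := by
  let f : ℝ × ℝ → ℝ × ℝ := fun p => (1 / (p.1 - (⌊p.1⌋₊ : ℤ)), 1 / ((⌊p.1⌋₊ : ℤ) + p.2))
  let z : ℕ → ℝ × ℝ := fun n => f^[n] (x, y)
  have hz : ∀ n, z (n + 1) = f (z n) := fun n => Function.iterate_succ_apply' f n (x, y)
  have main : ∀ p : ℝ × ℝ, RootPair m p.1 p.2 → 1 < p.1 → 0 < p.2 → p.2 < 1 →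
      1 ≤ ⌊p.1⌋₊ ∧ 0 < p.1 - (⌊p.1⌋₊ : ℤ) ∧ p.1 - (⌊p.1⌋₊ : ℤ) < 1 := by
    intro p hp h1 h2 h3
    refine ⟨Nat.le_floor (by simpa using h1.le), ?_, ?_⟩
    · have hle : ((⌊p.1⌋₊ : ℤ) : ℝ) ≤ p.1 := by
        have := Nat.floor_le (by linarith : 0 ≤ p.1); exact_mod_cast this
      have hne : ((⌊p.1⌋₊ : ℤ), (1 : ℤ)) ≠ (0, 0) := by simp
      have := hp.ne_left hm (by linarith) hne
      rcases hle.lt_or_eq with h | h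
      · linarith
      · exact absurd (by rw [h]; push_cast; ring) this
    · have := Nat.lt_floor_add_one p.1
      push_cast; linarith
  have inv : ∀ n, RootPair m (z n).1 (z n).2 ∧ 1 < (z n).1 ∧ 0 < (z n).2 ∧ (z n).2 < 1 := by
    intro n
    induction n with
    | zero => exact ⟨h, hx, hy, hy1⟩
    | succ n ih =>
      obtain ⟨h1, h2, h3, h4⟩ := ih
      obtain ⟨k1, k2, k3⟩ := main _ h1 h2 h3 h4
      have k1' : (1 : ℝ) ≤ (⌊(z n).1⌋₊ : ℤ) := by exact_mod_cast k1
      rw [hz]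
      refine ⟨h1.step _ k2 (by linarith), ?_, ?_, ?_⟩
      · change 1 < 1 / ((z n).1 - (⌊(z n).1⌋₊ : ℤ))
        rw [lt_div_iff₀ k2]; linarith
      · change 0 < 1 / (((⌊(z n).1⌋₊ : ℤ) : ℝ) + (z n).2)
        positivity
      · change 1 / (((⌊(z n).1⌋₊ : ℤ) : ℝ) + (z n).2) < 1
        rw [div_lt_one (by linarith)]; linarith
  refine ⟨fun n => ⌊(z n).1⌋₊, fun n => (z n).1, fun n => (z n).2, rfl, rfl, fun n => ?_⟩
  obtain ⟨h1, h2, h3, h4⟩ := inv n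
  obtain ⟨k1, k2, k3⟩ := main _ h1 h2 h3 h4
  refine ⟨k1, h2, h3, h4, h1.add_le hm, ?_, ?_⟩
  · simp only [hz, f]
    rw [one_div_one_div]; push_cast; ring
  · simp only [hz, f]
    push_cast; rfl

end RootPair

/-- Every element `m > 2` of the Markov spectrum is the Markov value of a bi-infinite sequence, and
it is attained at position `0`. -/
theorem exists_sequence_of_mem_markovSpectrum {m : ℝ} (hm : m ∈ markovSpectrum) (hm2 : 2 < m) :
    ∃ a : ℤ → ℕ, (∀ i, 1 ≤ a i) ∧ markovVal a 0 = m ∧ ∀ i, markovVal a i ≤ m := by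
  obtain ⟨hmpos, x, y, hy0, hy1, hxy, hP⟩ := exists_rootPair hm
  have hne01 : ((0 : ℤ), (1 : ℤ)) ≠ (0, 0) := by simp
  have hne11 : ((-1 : ℤ), (1 : ℤ)) ≠ (0, 0) := by simp
  have hy0' : 0 < y := by
    have := hP.ne_right hmpos (by linarith) hne01
    rcases hy0.lt_or_eq with h | h
    · exact h
    · exact absurd (by rw [← h]; simp) this
  have hy1' : y < 1 := by
    have := hP.ne_right hmpos (by linarith) hne11
    rcases hy1.lt_or_eq with h | h
    · exact h
    · exact absurd (by rw [h]; simp) this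
  have hx1 : 1 < x := by linarith
  obtain ⟨d, xs, ys, hxs0, hys0, hd⟩ := hP.exists_digits hmpos hx1 hy0' hy1'
  obtain ⟨e, xl, yl, hxl0, hyl0, he⟩ := (hP.swap (by linarith) hy0').exists_digits hmpos
    (by rw [lt_div_iff₀ hy0']; linarith) (by positivity) (by rw [div_lt_one (by linarith)]; exact hx1)
  let a : ℤ → ℕ := fun i => if 0 ≤ i then d i.toNat else e (-1 - i).toNat
  have ha : ∀ i, 1 ≤ a i := by
    intro i
    simp only [a]
    split_ifs
    · exact (hd _).1
    · exact (he _).1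
  have had : ∀ n : ℕ, a n = d n := fun n => by simp [a]
  have hae : ∀ n : ℕ, a (-1 - n) = e n := fun n => by
    have h1 : ¬ (0 : ℤ) ≤ -1 - n := by omega
    simp only [a, if_neg h1]; congr 1; omega
  have inv_mem : ∀ t : ℝ, 1 < t → 0 ≤ 1 / t ∧ 1 / t ≤ 1 := fun t ht =>
    ⟨by positivity, by rw [div_le_one (by linarith)]; exact ht.le⟩
  have hright : ∀ n : ℕ, rightCF a n = 1 / xs (n + 1) := by
    intro n
    symm
    apply eq_cfVal (fun _ => ha _) (x := fun k => 1 / xs (n + 1 + k))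
    · exact fun k => (inv_mem _ (hd _).2.1).1
    · exact fun k => (inv_mem _ (hd _).2.1).2
    · intro k
      have h1 : a ((n : ℤ) + 1 + k) = d (n + 1 + k) := by rw [← had]; push_cast; rfl
      simp only [h1]
      rw [(hd (n + 1 + k)).2.2.2.2.2.1]
      rfl
  have hleft : ∀ n : ℕ, leftCF a (-1 - n) = 1 / xl (n + 1) := by
    intro n
    symm
    apply eq_cfVal (fun _ => ha _) (x := fun k => 1 / xl (n + 1 + k))
    · exact fun k => (inv_mem _ (he _).2.1).1
    · exact fun k => (inv_mem _ (he _).2.1).2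
    · intro k
      have h1 : a (-1 - (n : ℤ) - 1 - k) = e (n + 1 + k) := by
        rw [← hae]; congr 1; push_cast; ring
      simp only [h1]
      rw [(he (n + 1 + k)).2.2.2.2.2.1]
      rfl
  have hleft0 : leftCF a 0 = y := by
    rw [leftCF_step ha]
    have h1 := hleft 0
    have h2 := hae 0
    have h3 := (he 0).2.2.2.2.2.1
    simp only [Nat.cast_zero, sub_zero] at h1 h2
    rw [show (0 : ℤ) - 1 = -1 by ring, h1, h2, ← h3, hxl0, one_div_one_div]
  have hright0 : rightCF a (-1) = 1 / x := by
    rw [rightCF_step ha]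
    have h1 := hright 0
    have h2 := had 0
    have h3 := (hd 0).2.2.2.2.2.1
    simp only [Nat.cast_zero] at h1 h2
    rw [show (-1 : ℤ) + 1 = 0 by ring, h1, h2, ← h3, hxs0]
  have hL : ∀ n : ℕ, leftCF a n = ys n := by
    intro n
    induction n with
    | zero => simpa [hys0] using hleft0
    | succ n ih =>
      rw [leftCF_step ha, (hd n).2.2.2.2.2.2]
      simp only [Nat.cast_succ, add_sub_cancel_right, ih, had]
  have hR : ∀ n : ℕ, rightCF a (-1 - n) = yl n := by
    intro n
    induction n with
    | zero => simpa [hyl0] using hright0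
    | succ n ih =>
      rw [rightCF_step ha, (he n).2.2.2.2.2.2]
      have : (-1 : ℤ) - (n + 1 : ℕ) + 1 = -1 - n := by push_cast; ring
      rw [this, ih, hae]
  refine ⟨a, ha, ?_, fun i => ?_⟩
  · have h0 := hright 0
    have h1 := had 0
    have h3 := (hd 0).2.2.2.2.2.1
    simp only [Nat.cast_zero] at h0 h1
    rw [markovVal, hleft0, h0, h1, ← h3, hxs0, hxy]
  · rcases le_or_gt 0 i with hi | hi
    · obtain ⟨n, rfl⟩ := Int.eq_ofNat_of_zero_le hi
      rw [markovVal, hL, hright, had, ← (hd n).2.2.2.2.2.1]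
      exact (hd n).2.2.2.2.1
    · obtain ⟨n, rfl⟩ : ∃ n : ℕ, i = -1 - n := ⟨(-1 - i).toNat, by omega⟩
      rw [markovVal, hR, hleft, hae]
      have h1 := (he n).2.2.2.2.2.1
      have h2 := (he n).2.2.2.2.1
      linarith

/-- The digits of `a` up to position `n` have a continuation that is eventually equal to `2` and
all of whose Markov values are at most `c`. -/
def Connects (a : ℤ → ℕ) (n : ℤ) (c : ℝ) : Prop :=
  ∃ b : ℤ → ℕ, (∀ i, 1 ≤ b i) ∧ (∀ i ≤ n, b i = a i) ∧ (∃ M, ∀ i, M ≤ i → b i = 2) ∧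
    ∀ i, markovVal b i ≤ c

theorem exists_four_div_lt {ε : ℝ} (hε : 0 < ε) : ∃ N : ℕ, ∀ n ≥ N, 4 / ((n : ℝ) + 1) < ε := by
  obtain ⟨N, hN⟩ := exists_two_div_lt (ε := ε / 2) (by linarith)
  refine ⟨N, fun n hn => ?_⟩
  have h : (4 : ℝ) / ((n : ℝ) + 1) = 2 * (2 / ((n : ℝ) + 1)) := by ring
  linarith [hN n hn]

/-- Continuations in both directions can be combined. -/
theorem exists_two_sided {a : ℤ → ℕ} {m : ℝ}
    (hr : ∀ ε > 0, ∀ N : ℕ, ∃ n : ℤ, N ≤ n ∧ Connects a n (m + ε))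
    (hl : ∀ ε > 0, ∀ N : ℕ, ∃ n : ℤ, N ≤ n ∧ Connects (fun i => a (-i)) n (m + ε))
    {ε : ℝ} (hε : 0 < ε) (N : ℕ) :
    ∃ b : ℤ → ℕ, (∀ i, 1 ≤ b i) ∧ (∀ i : ℤ, -(N : ℤ) ≤ i → i ≤ N → b i = a i) ∧
      (∃ M : ℕ, ∀ i : ℤ, (M : ℤ) ≤ |i| → b i = 2) ∧ ∀ i, markovVal b i ≤ m + ε := by
  obtain ⟨N', hN'⟩ := exists_four_div_lt (ε := ε / 2) (by linarith)
  obtain ⟨n, hn, b, hb, hba, ⟨M, hM⟩, hbm⟩ := hr (ε / 2) (by linarith) (N + N')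
  obtain ⟨n', hn', c, hc, hca, ⟨M', hM'⟩, hcm⟩ := hl (ε / 2) (by linarith) (N + N')
  let g : ℤ → ℕ := fun i => if 0 ≤ i then b i else c (-i)
  have hg1 : ∀ i, 1 ≤ g i := by
    intro i; simp only [g]; split_ifs
    · exact hb _
    · exact hc _
  have hgb : ∀ i : ℤ, -((N + N' : ℕ) : ℤ) ≤ i → g i = b i := by
    intro i hi
    simp only [g]
    split_ifs with h
    · rfl
    · rw [hca _ (by push_cast at *; omega), hba _ (by push_cast at *; omega)]; simp
  have hgc : ∀ i : ℤ, i ≤ ((N + N' : ℕ) : ℤ) → g i = c (-i) := by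
    intro i hi
    simp only [g]
    split_ifs with h
    · rw [hca _ (by push_cast at *; omega), hba _ (by push_cast at *; omega)]; simp
    · rfl
  refine ⟨g, hg1, ?_, ⟨M.natAbs + M'.natAbs, ?_⟩, ?_⟩
  · intro i h1 h2
    rw [hgb i (by push_cast; omega), hba _ (by push_cast at *; omega)]
  · intro i hi
    simp only [g]
    split_ifs with h
    · rw [abs_of_nonneg h] at hi
      exact hM _ (by omega)
    · rw [abs_of_neg (by omega)] at hi
      exact hM' _ (by omega)
  · intro i
    rcases le_total 0 i with h | h
    · have h1 := abs_markovVal_sub_le hg1 hb i (N := N') fun j h1 h2 => hgb j (by push_cast; omega)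
      have h2 := (abs_le.1 h1).2
      linarith [hbm i, hN' N' le_rfl]
    · have h1 := abs_markovVal_sub_le hg1 (b := fun i => c (-i)) (fun _ => hc _) i (N := N')
        fun j h1 h2 => hgc j (by push_cast; omega)
      have h2 := (abs_le.1 h1).2
      rw [markovVal_rev] at h2
      linarith [hcm (-i), hN' N' le_rfl]

theorem markovVal_le_of_digit {a : ℤ → ℕ} (ha : ∀ i, 1 ≤ a i) (i : ℤ) :
    markovVal a i ≤ a i + 2 := by
  have := rightCF_lt_one ha i
  have := leftCF_lt_one ha i
  unfold markovVal; linarith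

theorem digit_le_of_markovVal {a : ℤ → ℕ} (ha : ∀ i, 1 ≤ a i) {i : ℤ} {c : ℝ} {k : ℕ}
    (h : markovVal a i ≤ c) (hc : c ≤ k + 1) : a i ≤ k := by
  have h1 := rightCF_pos ha i
  have h2 := leftCF_pos ha i
  unfold markovVal at h
  have : (a i : ℝ) < k + 1 := by linarith
  have : a i < k + 1 := by exact_mod_cast this
  omega

/-- Bi-infinite sequences that are eventually `2` on both sides can be concatenated. -/
theorem exists_concatenation (b : ℕ → ℤ → ℕ) (M : ℕ → ℕ)
    (hM : ∀ k (i : ℤ), (M k : ℤ) ≤ |i| → b k i = 2) :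
    ∃ (c : ℤ → ℕ) (p : ℕ → ℤ), (∀ k, k ≤ p k) ∧
      (∀ k (i : ℤ), |i| ≤ M k + k → c (p k + i) = b k i) ∧
      ∀ i, c i ≠ 2 → ∃ k, |i - p k| < M k := by
  let s : ℕ → ℕ := fun k => M k + k + 1
  let p : ℕ → ℤ := fun k => (∑ i ∈ Finset.range k, 2 * (s i : ℤ)) + s k
  have hp : ∀ k l, k < l → p k + s k + s l ≤ p l := by
    intro k l hkl
    have : ∑ i ∈ Finset.range (k + 1), 2 * (s i : ℤ) ≤ ∑ i ∈ Finset.range l, 2 * (s i : ℤ) := by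
      apply Finset.sum_le_sum_of_subset_of_nonneg
      · exact Finset.range_subset_range.2 (by omega)
      · intros; positivity
    rw [Finset.sum_range_succ] at this
    simp only [p]; linarith
  have huniq : ∀ k l (i : ℤ), |i - p k| < s k → |i - p l| < s l → k = l := by
    intro k l i hk hl
    rw [abs_lt] at hk hl
    rcases lt_trichotomy k l with h | h | h
    · have := hp k l h; omega
    · exact h
    · have := hp l k h; omega
  classical
  refine ⟨fun i => if h : ∃ k, |i - p k| < s k then b h.choose (i - p h.choose) else 2, p, ?_, ?_, ?_⟩
  · intro k
    have : (0 : ℤ) ≤ ∑ i ∈ Finset.range k, 2 * (s i : ℤ) := Finset.sum_nonneg fun _ _ => by positivity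
    simp only [p]
    have hs : (k : ℤ) ≤ s k := by simp only [s]; push_cast; omega
    linarith
  · intro k i hi
    have hk : |p k + i - p k| < s k := by
      rw [add_sub_cancel_left]; simp only [s]; push_cast; omega
    have hex : ∃ k', |p k + i - p k'| < s k' := ⟨k, hk⟩
    have hch : hex.choose = k := huniq _ _ _ hex.choose_spec hk
    simp only [dif_pos hex, hch, add_sub_cancel_left]
  · intro i hi
    by_cases hex : ∃ k, |i - p k| < s k
    · simp only [dif_pos hex] at hi
      refine ⟨hex.choose, ?_⟩
      by_contra! h
      exact hi (hM _ _ h)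
    · simp only [dif_neg hex] at hi
      exact absurd rfl hi

/-- If the central digits of `a` can be connected to the sequence `222…` on both sides with Markov
values arbitrarily close to the Markov value `m` of `a`, then `m` is in the Lagrange spectrum. -/
theorem mem_lagrangeSpectrum_of_connects {a : ℤ → ℕ} {m : ℝ} (ha : ∀ i, 1 ≤ a i) (hm : 4 < m)
    (hm5 : m < 5) (ha0 : markovVal a 0 = m)
    (hr : ∀ ε > 0, ∀ N : ℕ, ∃ n : ℤ, N ≤ n ∧ Connects a n (m + ε))
    (hl : ∀ ε > 0, ∀ N : ℕ, ∃ n : ℤ, N ≤ n ∧ Connects (fun i => a (-i)) n (m + ε)) :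
    m ∈ lagrangeSpectrum := by
  have hε : ∀ k : ℕ, 0 < (5 - m) * (1 / ((k : ℝ) + 1)) := fun k => by
    have : 0 < 5 - m := by linarith
    positivity
  choose b hb hba hM hbm using fun k : ℕ => exists_two_sided hr hl (hε k) k
  choose M hM using hM
  obtain ⟨c, p, hpk, hcb, hc2⟩ := exists_concatenation b M hM
  have hεle : ∀ k : ℕ, (5 - m) * (1 / ((k : ℝ) + 1)) ≤ 5 - m := by
    intro k
    have h0 : 0 < 5 - m := by linarith
    have : 1 / ((k : ℝ) + 1) ≤ 1 := by
      rw [div_le_one (by positivity)]; linarith [(Nat.cast_nonneg k : (0 : ℝ) ≤ k)]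
    nlinarith
  have hc : ∀ i, 1 ≤ c i ∧ c i ≤ 4 := by
    intro i
    by_cases h : c i = 2
    · omega
    · obtain ⟨k, hk⟩ := hc2 i h
      have := hcb k (i - p k) (by omega)
      rw [add_sub_cancel] at this
      rw [this]
      refine ⟨hb _ _, digit_le_of_markovVal (hb k) (hbm k _) ?_⟩
      push_cast; linarith [hεle k]
  have hshift : ∀ (k : ℕ) (i : ℤ), |i - p k| ≤ M k →
      |markovVal c i - markovVal (b k) (i - p k)| ≤ 4 / ((k : ℝ) + 1) := by
    intro k i hi
    have h1 := abs_markovVal_sub_le (a := fun j => c (p k + j)) (fun _ => (hc _).1) (hb k) (i - p k)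
      (N := k) (fun j h1 h2 => hcb k j (by rw [abs_le] at *; omega))
    have h2 : markovVal (fun j => c (p k + j)) (i - p k) = markovVal c i := by
      simp only [markovVal, rightCF, leftCF]
      have e0 : c (p k + (i - p k)) = c i := congrArg c (by ring)
      have e1 : (fun j : ℕ => c (p k + (i - p k + 1 + j))) = fun j : ℕ => c (i + 1 + j) :=
        funext fun j => congrArg c (by ring)
      have e2 : (fun j : ℕ => c (p k + (i - p k - 1 - j))) = fun j : ℕ => c (i - 1 - j) :=
        funext fun j => congrArg c (by ring)
      rw [e0, e1, e2]
    rwa [h2] at h1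
  have hsmall : ∀ ε > 0, ∃ K : ℕ, ∀ k ≥ K, (5 - m) * (1 / ((k : ℝ) + 1)) + 4 / ((k : ℝ) + 1) < ε := by
    intro ε hε
    obtain ⟨K, hK⟩ := exists_four_div_lt (ε := ε / 2) (by linarith)
    refine ⟨K, fun k hk => ?_⟩
    have h1 := hK k hk
    have h2 : (5 - m) * (1 / ((k : ℝ) + 1)) ≤ 4 / ((k : ℝ) + 1) := by
      rw [mul_one_div]; gcongr; linarith
    linarith
  apply mem_lagrangeSpectrum_of_markovVal (fun i => (hc i).1) (fun i => (hc i).2) (by linarith)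
  · intro ε hε
    obtain ⟨K, hK⟩ := hsmall ε hε
    have hbd : ∃ B : ℕ, ∀ k < K, p k + M k ≤ B := by
      refine ⟨∑ k ∈ Finset.range K, (p k + M k).natAbs, fun k hk => ?_⟩
      have h1 := Finset.single_le_sum (f := fun k => (p k + M k).natAbs) (fun _ _ => Nat.zero_le _)
        (Finset.mem_range.2 hk)
      have h2 : p k + M k ≤ ((p k + M k).natAbs : ℤ) := Int.le_natAbs
      exact h2.trans (by exact_mod_cast h1)
    obtain ⟨B, hB⟩ := hbd
    refine ⟨B, fun n hn => ?_⟩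
    by_cases h : c n = 2
    · have := markovVal_le_of_digit (fun i => (hc i).1) (n : ℤ)
      rw [h] at this; push_cast at this; linarith
    · obtain ⟨k, hk⟩ := hc2 _ h
      have hkK : K ≤ k := by
        by_contra! hlt
        have := hB k hlt
        rw [abs_lt] at hk; omega
      have h1 := (abs_le.1 (hshift k n hk.le)).2
      have h2 := hbm k (n - p k)
      have h3 := hK k hkK
      linarith
  · intro ε hε N
    obtain ⟨K, hK⟩ := hsmall (ε / 2) (by linarith)
    obtain ⟨n, hn⟩ := Int.eq_ofNat_of_zero_le (le_trans (by positivity) (hpk (N + K)))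
    refine ⟨n, by have := hpk (N + K); omega, ?_⟩
    have h1 := (abs_le.1 (hshift (N + K) n (by rw [hn]; simp))).1
    have h2 : |markovVal (b (N + K)) 0 - markovVal a 0| ≤ 4 / (((N + K : ℕ) : ℝ) + 1) :=
      abs_markovVal_sub_le (hb _) ha 0 (N := N + K) fun j h1 h2 => hba _ j (by omega) (by omega)
    have h3 := (abs_le.1 h2).1
    have h4 := hK (N + K) (by omega)
    have h5 := hε
    have h6 : 0 < (5 - m) * (1 / (((N + K : ℕ) : ℝ) + 1)) := by
      have : 0 < 5 - m := by linarith
      positivity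
    rw [hn, sub_self] at h1
    rw [ha0] at h3
    linarith

/-- Digits `1, …, 4`, where `4` stands next to digits `3` and `4` only. -/
def Admissible (a : ℤ → ℕ) : Prop :=
  ∀ i, 1 ≤ a i ∧ a i ≤ 4 ∧ (a i = 4 → 3 ≤ a (i + 1) ∧ 3 ≤ a (i - 1))

theorem Admissible.rev {a : ℤ → ℕ} (ha : Admissible a) : Admissible (fun i => a (-i)) := by
  intro i
  refine ⟨(ha _).1, (ha _).2.1, fun h => ?_⟩
  have := (ha _).2.2 h
  change 3 ≤ a (-(i + 1)) ∧ 3 ≤ a (-(i - 1))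
  rw [show -(i + 1) = -i - 1 by ring, show -(i - 1) = -i + 1 by ring]
  exact ⟨this.2, this.1⟩

theorem one_div_mem {d l u x : ℝ} (hl : 0 < d + l) (h1 : l ≤ x) (h2 : x ≤ u) :
    1 / (d + u) ≤ 1 / (d + x) ∧ 1 / (d + x) ≤ 1 / (d + l) :=
  ⟨one_div_le_one_div_of_le (by linarith) (by linarith),
    one_div_le_one_div_of_le (by linarith) (by linarith)⟩

theorem rightCF_bounds {a : ℤ → ℕ} (ha : ∀ i, 1 ≤ a i ∧ a i ≤ 4) (i : ℤ) :
    1 / 5 ≤ rightCF a i ∧ rightCF a i ≤ 5 / 6 := by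
  have h1 : ∀ j, 1 / 5 ≤ rightCF a j := by
    intro j
    rw [rightCF_step fun i => (ha i).1]
    have := rightCF_pos (fun i => (ha i).1) (j + 1)
    have := rightCF_lt_one (fun i => (ha i).1) (j + 1)
    have : (a (j + 1) : ℝ) ≤ 4 := by exact_mod_cast (ha (j + 1)).2
    exact one_div_le_one_div_of_le (by positivity) (by linarith)
  refine ⟨h1 i, ?_⟩
  rw [rightCF_step fun i => (ha i).1]
  have := h1 (i + 1)
  have : (1 : ℝ) ≤ a (i + 1) := by exact_mod_cast (ha (i + 1)).1
  rw [div_le_div_iff₀ (by linarith) (by norm_num)]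
  linarith

theorem leftCF_bounds {a : ℤ → ℕ} (ha : ∀ i, 1 ≤ a i ∧ a i ≤ 4) (i : ℤ) :
    1 / 5 ≤ leftCF a i ∧ leftCF a i ≤ 5 / 6 := by
  have := rightCF_bounds (a := fun i => a (-i)) (fun i => ha _) (-i)
  rwa [rightCF_rev, neg_neg] at this

/-- The word `41` forces a Markov value above `√21`. -/
theorem two_le_of_four {a : ℤ → ℕ} (ha : ∀ i, 1 ≤ a i ∧ a i ≤ 4) {c : ℝ} (hc : c < 229129 / 50000)
    (h : ∀ i, markovVal a i ≤ c) {i : ℤ} (hi : a i = 4) : 2 ≤ a (i + 1) := by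
  by_contra! hlt
  have h1 : a (i + 1) = 1 := by have := (ha (i + 1)).1; omega
  have h2 := h i
  have h3 := (leftCF_bounds ha i).1
  have h4 : 1 / 2 ≤ rightCF a i := by
    rw [rightCF_step fun i => (ha i).1, h1]
    have := rightCF_pos (fun i => (ha i).1) (i + 1)
    have := rightCF_lt_one (fun i => (ha i).1) (i + 1)
    exact one_div_le_one_div_of_le (by positivity) (by push_cast; linarith)
  rw [markovVal, hi] at h2
  push_cast at h2
  linarith

/-- The word `42` forces a Markov value above `√21`. -/
theorem three_le_of_four {a : ℤ → ℕ} (ha : ∀ i, 1 ≤ a i ∧ a i ≤ 4) {c : ℝ} (hc : c < 229129 / 50000)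
    (h : ∀ i, markovVal a i ≤ c) {i : ℤ} (hi : a i = 4) : 3 ≤ a (i + 1) := by
  have ha1 : ∀ i, 1 ≤ a i := fun i => (ha i).1
  have hrev : ∀ i, markovVal (fun i => a (-i)) i ≤ c := fun i => by rw [markovVal_rev]; exact h _
  have hr := @two_le_of_four a ha c hc h
  have hl : ∀ i, a i = 4 → 2 ≤ a (i - 1) := by
    intro i hi
    have := two_le_of_four (a := fun i => a (-i)) (fun i => ha _) hc hrev (i := -i) (by simpa using hi)
    simpa [sub_eq_add_neg, add_comm] using this
  have hdig : ∀ i, (a i : ℝ) ≤ 4 := fun i => by exact_mod_cast (ha i).2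
  have hlo : ∀ j, 2 / 9 ≤ leftCF a j := by
    intro j
    rw [leftCF_step ha1]
    have h0 := leftCF_pos ha1 (j - 1)
    have h1 := leftCF_lt_one ha1 (j - 1)
    have hpos : (0 : ℝ) < a (j - 1) + leftCF a (j - 1) := by positivity
    rw [div_le_div_iff₀ (by norm_num) hpos]
    rcases (ha (j - 1)).2.lt_or_eq with h4 | h4
    · have : (a (j - 1) : ℝ) ≤ 3 := by exact_mod_cast Nat.lt_succ_iff.1 h4
      linarith
    · have h2 : leftCF a (j - 1) ≤ 1 / 2 := by
        rw [leftCF_step ha1]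
        have h5 := leftCF_pos ha1 (j - 1 - 1)
        have : (2 : ℝ) ≤ a (j - 1 - 1) := by exact_mod_cast hl _ h4
        exact one_div_le_one_div_of_le (by norm_num) (by linarith)
      have := hdig (j - 1)
      linarith
  have hhi : ∀ j, rightCF a j ≤ 4 / 5 := by
    intro j
    rw [rightCF_step ha1]
    have h0 := rightCF_pos ha1 (j + 1)
    rw [div_le_div_iff₀ (by positivity) (by norm_num)]
    rcases (ha (j + 1)).1.eq_or_lt with h1 | h1
    · have hne : a (j + 1 + 1) ≠ 4 := by
        intro h4
        have := hl _ h4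
        rw [add_sub_cancel_right] at this
        omega
      have h3 : (a (j + 1 + 1) : ℝ) ≤ 3 := by
        have := (ha (j + 1 + 1)).2
        exact_mod_cast (by omega : a (j + 1 + 1) ≤ 3)
      have h2 : 1 / 4 ≤ rightCF a (j + 1) := by
        rw [rightCF_step ha1]
        have h5 := rightCF_pos ha1 (j + 1 + 1)
        have h6 := rightCF_lt_one ha1 (j + 1 + 1)
        exact one_div_le_one_div_of_le (by positivity) (by linarith)
      rw [← h1]; push_cast; linarith
    · have : (2 : ℝ) ≤ a (j + 1) := by exact_mod_cast h1
      linarith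
  by_contra! hlt
  have h2 : a (i + 1) = 2 := by have := hr hi; omega
  have hL : 1 / (89 / 20) ≤ leftCF a i := by
    rw [leftCF_step ha1]
    have h0 := leftCF_pos ha1 (i - 1)
    have hle : leftCF a (i - 1) ≤ 9 / 20 ∨ (a (i - 1) : ℝ) ≤ 3 := by
      rcases (ha (i - 1)).2.lt_or_eq with h4 | h4
      · right; exact_mod_cast Nat.lt_succ_iff.1 h4
      · left
        rw [leftCF_step ha1]
        have := hlo (i - 1 - 1)
        have : (2 : ℝ) ≤ a (i - 1 - 1) := by exact_mod_cast hl _ h4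
        rw [div_le_iff₀ (by linarith)]; linarith
    apply one_div_le_one_div_of_le (by positivity)
    have := hdig (i - 1)
    have := leftCF_lt_one ha1 (i - 1)
    rcases hle with h | h <;> linarith
  have hR : 179 / 500 ≤ rightCF a i := by
    have h1 : rightCF a (i + 1) ≤ 19 / 24 := by
      rw [rightCF_step ha1]
      have h0 := rightCF_pos ha1 (i + 1 + 1)
      rw [div_le_div_iff₀ (by positivity) (by norm_num)]
      rcases (ha (i + 1 + 1)).1.eq_or_lt with h1 | h1
      · have hne : a (i + 1 + 1 + 1) ≠ 4 := by
          intro h4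
          have := hl _ h4
          rw [add_sub_cancel_right] at this
          omega
        have h3 : (a (i + 1 + 1 + 1) : ℝ) ≤ 3 := by
          have := (ha (i + 1 + 1 + 1)).2
          exact_mod_cast (by omega : a (i + 1 + 1 + 1) ≤ 3)
        have h2 : 1 / (19 / 5) ≤ rightCF a (i + 1 + 1) := by
          rw [rightCF_step ha1]
          have h5 := rightCF_pos ha1 (i + 1 + 1 + 1)
          have h6 := hhi (i + 1 + 1 + 1)
          exact one_div_le_one_div_of_le (by positivity) (by linarith)
        rw [← h1]; push_cast; linarith
      · have : (2 : ℝ) ≤ a (i + 1 + 1) := by exact_mod_cast h1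
        linarith
    rw [rightCF_step ha1, h2]
    have h0 := rightCF_pos ha1 (i + 1)
    rw [le_div_iff₀ (by positivity)]
    push_cast; linarith
  have h3 := h i
  rw [markovVal, hi] at h3
  push_cast at h3
  linarith

theorem admissible_of_markovVal_le {a : ℤ → ℕ} (ha : ∀ i, 1 ≤ a i) {c : ℝ} (hc : c < 229129 / 50000)
    (h : ∀ i, markovVal a i ≤ c) : Admissible a := by
  have ha4 : ∀ i, 1 ≤ a i ∧ a i ≤ 4 := fun i =>
    ⟨ha i, digit_le_of_markovVal ha (h i) (by push_cast; linarith)⟩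
  refine fun i => ⟨ha i, (ha4 i).2, fun hi => ⟨three_le_of_four ha4 hc h hi, ?_⟩⟩
  have := three_le_of_four (a := fun i => a (-i)) (fun i => ha4 _) hc
    (fun i => by rw [markovVal_rev]; exact h _) (i := -i) (by simpa using hi)
  simpa [sub_eq_add_neg, add_comm] using this

/-- The sequence that starts with the word `v` and goes on with `222…`. -/
def wordSeq (v : List ℕ) : ℕ → ℕ := fun k => v.getD k 2

theorem one_le_wordSeq {v : List ℕ} (hv : ∀ d ∈ v, 1 ≤ d) (k : ℕ) : 1 ≤ wordSeq v k := by
  unfold wordSeq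
  by_cases h : k < v.length
  · rw [List.getD_eq_getElem _ _ h]; exact hv _ (List.getElem_mem h)
  · rw [List.getD_eq_default _ _ (by omega)]; norm_num

/-- The value of `[0; v, 2, 2, 2, …]`. -/
noncomputable def wordVal (v : List ℕ) : ℝ := cfVal (wordSeq v)

theorem wordVal_cons {d : ℕ} {v : List ℕ} (hv : ∀ e ∈ d :: v, 1 ≤ e) :
    wordVal (d :: v) = 1 / (d + wordVal v) := by
  unfold wordVal
  rw [cfVal_step (one_le_wordSeq hv)]
  rfl

theorem wordVal_nonneg {v : List ℕ} (hv : ∀ e ∈ v, 1 ≤ e) : 0 ≤ wordVal v :=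
  cfVal_nonneg (one_le_wordSeq hv)

theorem wordVal_le_one {v : List ℕ} (hv : ∀ e ∈ v, 1 ≤ e) : wordVal v ≤ 1 :=
  cfVal_le_one (one_le_wordSeq hv)

theorem wordVal_nil : 2 / 5 ≤ wordVal [] ∧ wordVal [] ≤ 1 / 2 := by
  have h : wordVal [] = 1 / ((2 : ℕ) + wordVal []) := by
    conv_lhs => rw [wordVal, cfVal_step (one_le_wordSeq (by simp))]
    rfl
  have h0 : 0 ≤ wordVal [] := wordVal_nonneg (by simp)
  have h1 : wordVal [] ≤ 1 / 2 := by
    rw [h]; exact one_div_le_one_div_of_le (by norm_num) (by push_cast; linarith)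
  refine ⟨?_, h1⟩
  rw [h, le_div_iff₀ (by positivity)]; push_cast; linarith

/-- The Markov values at the digits `≥ 3` of the word `v` are at most `c`, if `v` is preceded by
digits with left continued fraction `z` and followed by `222…`. -/
def Fits (c : ℝ) : ℝ → List ℕ → Prop
  | _, [] => True
  | z, d :: v => (3 ≤ d → d + wordVal v + z ≤ c) ∧ Fits c (1 / (d + z)) v

theorem markovVal_le_of_fits {c : ℝ} (hc : 4 ≤ c) {v : List ℕ} (hv : ∀ d ∈ v, 1 ≤ d) {b : ℤ → ℕ}
    (hb : ∀ i, 1 ≤ b i) {n : ℤ} (hbv : ∀ k : ℕ, b (n + 1 + k) = wordSeq v k)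
    (hf : Fits c (leftCF b (n + 1)) v) {i : ℤ} (hi : n < i) : markovVal b i ≤ c := by
  induction v generalizing n with
  | nil =>
    have h2 : b i = 2 := by
      have := hbv (i - n - 1).toNat
      rw [show n + 1 + ((i - n - 1).toNat : ℤ) = i by omega] at this
      rw [this]; simp [wordSeq]
    have := markovVal_le_of_digit hb i
    rw [h2] at this; push_cast at this; linarith
  | cons d v ih =>
    have hd : b (n + 1) = d := by simpa [wordSeq] using hbv 0
    have hbv' : ∀ k : ℕ, b (n + 1 + 1 + k) = wordSeq v k := by
      intro k
      have := hbv (k + 1)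
      rw [show n + 1 + 1 + (k : ℤ) = n + 1 + ((k + 1 : ℕ) : ℤ) by push_cast; ring, this]
      rfl
    rcases (by omega : i = n + 1 ∨ n + 1 < i) with rfl | hi'
    · rcases Nat.lt_or_ge d 3 with h3 | h3
      · have := markovVal_le_of_digit hb (n + 1)
        rw [hd] at this
        have h4 : (d : ℝ) ≤ 2 := by exact_mod_cast Nat.lt_succ_iff.1 h3
        linarith
      · have := hf.1 h3
        have hR : rightCF b (n + 1) = wordVal v := by
          unfold rightCF wordVal; congr 1; ext k; exact hbv' k
        rw [markovVal, hd, hR]; exact this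
    · refine ih (fun e he => hv e (List.mem_cons_of_mem _ he)) hbv' ?_ hi'
      rw [leftCF_step hb, add_sub_cancel_right, hd]
      exact hf.2

/-- Sequences none of whose initial parts beyond position `N` connect to `222…`. -/
structure Isolated (q ε : ℝ) (N : ℕ) (a : ℤ → ℕ) : Prop where
  admissible : Admissible a
  markovVal_le : ∀ i, markovVal a i ≤ q
  not_connects : ∀ n : ℤ, N ≤ n → ¬ Connects a n (q + ε)

theorem one_div_mem_uIcc {d x y z : ℝ} (hd : 0 < d) (hx : 0 ≤ x) (hy : 0 ≤ y) (hz : 0 ≤ z)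
    (h : x ∈ Set.uIcc y z) : 1 / (d + x) ∈ Set.uIcc (1 / (d + y)) (1 / (d + z)) := by
  rw [Set.mem_uIcc] at *
  rcases h with ⟨h1, h2⟩ | ⟨h1, h2⟩
  · right
    exact ⟨one_div_le_one_div_of_le (by linarith) (by linarith),
      one_div_le_one_div_of_le (by linarith) (by linarith)⟩
  · left
    exact ⟨one_div_le_one_div_of_le (by linarith) (by linarith),
      one_div_le_one_div_of_le (by linarith) (by linarith)⟩

/-- The assumptions under which two isolated sequences are compared: they agree up to `n`. -/
structure Branch (q ε : ℝ) (N : ℕ) (a a' : ℤ → ℕ) (n : ℤ) : Prop where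
  left : Isolated q ε N a
  right : Isolated q ε N a'
  agree : ∀ i, -(N : ℤ) ≤ i → i ≤ n → a i = a' i
  le : N ≤ n
  err : 2 / ((N : ℝ) + 1) ≤ ε
  bound : 559 / 125 ≤ q

namespace Branch
variable {q ε : ℝ} {N : ℕ} {a a' : ℤ → ℕ} {n : ℤ}

theorem symm (h : Branch q ε N a a' n) : Branch q ε N a' a n :=
  ⟨h.right, h.left, fun i h1 h2 => (h.agree i h1 h2).symm, h.le, h.err, h.bound⟩

theorem digits (h : Branch q ε N a a' n) : ∀ i, 1 ≤ a i ∧ a i ≤ 4 :=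
  fun i => ⟨(h.left.admissible i).1, (h.left.admissible i).2.1⟩

theorem succ (h : Branch q ε N a a' n) (ha : a (n + 1) = a' (n + 1)) :
    Branch q ε N a a' (n + 1) := by
  refine ⟨h.left, h.right, fun i h1 h2 => ?_, by have := h.le; omega, h.err, h.bound⟩
  rcases (by omega : i ≤ n ∨ i = n + 1) with h3 | rfl
  · exact h.agree i h1 h3
  · exact ha

/-- No continuation by `v222…` with small Markov values lies between two isolated sequences. -/
theorem false_of_between (h : Branch q ε N a a' n) {v : List ℕ} (hv : ∀ d ∈ v, 1 ≤ d)
    (hf : Fits (q + ε) (leftCF a (n + 1)) v)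
    (hbt : wordVal v ∈ Set.uIcc (rightCF a n) (rightCF a' n)) : False := by
  have ha : ∀ i, 1 ≤ a i := fun i => (h.digits i).1
  have ha' : ∀ i, 1 ≤ a' i := fun i => (h.symm.digits i).1
  have hNn := h.le
  have hε : 0 ≤ ε := le_trans (by positivity) h.err
  have hq : (4 : ℝ) ≤ q := by have := h.bound; linarith
  let b : ℤ → ℕ := fun i => if i ≤ n then a i else wordSeq v (i - n - 1).toNat
  have hb : ∀ i, 1 ≤ b i := by
    intro i; simp only [b]; split_ifs
    · exact ha i
    · exact one_le_wordSeq hv _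
  have hba : ∀ i ≤ n, b i = a i := fun i hi => by simp [b, hi]
  have hbv : ∀ k : ℕ, b (n + 1 + k) = wordSeq v k := by
    intro k
    have h1 : ¬ n + 1 + (k : ℤ) ≤ n := by omega
    simp only [b, if_neg h1]; congr 1; omega
  have hR : ∀ k : ℕ, (k : ℤ) ≤ n + N + 1 →
      rightCF b (n - k) ∈ Set.uIcc (rightCF a (n - k)) (rightCF a' (n - k)) := by
    intro k
    induction k with
    | zero =>
      intro _
      have : rightCF b n = wordVal v := by
        unfold rightCF wordVal; congr 1; ext k; exact hbv k
      simpa [this] using hbt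
    | succ k ih =>
      intro hk
      have ih := ih (by push_cast at hk; omega)
      have e : n - ((k + 1 : ℕ) : ℤ) + 1 = n - k := by push_cast; ring
      rw [rightCF_step hb, rightCF_step ha, rightCF_step ha', e, hba _ (by omega),
        ← h.agree (n - k) (by push_cast at hk; omega) (by omega)]
      exact one_div_mem_uIcc (by exact_mod_cast ha _) (rightCF_pos hb _).le (rightCF_pos ha _).le
        (rightCF_pos ha' _).le ih
  refine h.left.not_connects n h.le ⟨b, hb, hba, ⟨n + 1 + v.length, fun i hi => ?_⟩, fun i => ?_⟩
  · have := hbv (i - n - 1).toNat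
    rw [show n + 1 + ((i - n - 1).toNat : ℤ) = i by omega] at this
    rw [this, wordSeq, List.getD_eq_default _ _ (by omega)]
  · rcases lt_or_ge n i with hi | hi
    · refine markovVal_le_of_fits (by linarith) hv hb hbv ?_ hi
      rw [leftCF_congr (b := a) fun j hj => hba j (by omega)]
      exact hf
    · have hL : leftCF b i = leftCF a i := leftCF_congr fun j hj => hba j (by omega)
      have hqa := h.left.markovVal_le i
      have herr := h.err
      rcases lt_or_ge i 0 with hi0 | hi0
      · have h1 := (abs_le.1 (abs_rightCF_sub_le hb ha i (N := N) fun j h1 h2 =>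
          hba j (by omega))).2
        rw [markovVal, hba i hi, hL]
        rw [markovVal] at hqa
        linarith
      · have h1 := hR (n - i).toNat (by omega)
        rw [show n - ((n - i).toNat : ℤ) = i by omega, Set.mem_uIcc] at h1
        have h2 := (abs_le.1 (abs_leftCF_sub_le ha ha' i (N := N) fun j h1 h2 =>
          h.agree j (by omega) (by omega))).2
        have hqa' := h.right.markovVal_le i
        rw [markovVal, ← h.agree i (by omega) hi] at hqa'
        rw [markovVal, hba i hi, hL]
        rw [markovVal] at hqa
        rcases h1 with h1 | h1 <;> linarith [h1.1, h1.2]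

end Branch

section compare
variable {a : ℤ → ℕ} {n : ℤ} {d : ℕ} {v : List ℕ}

theorem rightCF_le_wordVal_of_lt (ha : ∀ i, 1 ≤ a i ∧ a i ≤ 4) (hv : ∀ e ∈ d :: v, 1 ≤ e)
    (h : d < a (n + 1)) : rightCF a n ≤ wordVal (d :: v) := by
  have hv' : ∀ e ∈ v, 1 ≤ e := fun e he => hv e (List.mem_cons_of_mem _ he)
  have hd : (1 : ℝ) ≤ d := by exact_mod_cast hv d List.mem_cons_self
  rw [rightCF_step fun i => (ha i).1, wordVal_cons hv]
  have h1 := wordVal_nonneg hv'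
  have h2 := wordVal_le_one hv'
  have h3 := rightCF_pos (fun i => (ha i).1) (n + 1)
  have h4 : (d : ℝ) + 1 ≤ a (n + 1) := by exact_mod_cast h
  exact one_div_le_one_div_of_le (by linarith) (by linarith)

theorem wordVal_le_rightCF_of_lt (ha : ∀ i, 1 ≤ a i ∧ a i ≤ 4) (hv : ∀ e ∈ d :: v, 1 ≤ e)
    (h : a (n + 1) < d) : wordVal (d :: v) ≤ rightCF a n := by
  have hv' : ∀ e ∈ v, 1 ≤ e := fun e he => hv e (List.mem_cons_of_mem _ he)
  rw [rightCF_step fun i => (ha i).1, wordVal_cons hv]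
  have h1 := wordVal_nonneg hv'
  have h3 := rightCF_pos (fun i => (ha i).1) (n + 1)
  have h5 := rightCF_lt_one (fun i => (ha i).1) (n + 1)
  have h4 : (a (n + 1) : ℝ) + 1 ≤ d := by exact_mod_cast h
  exact one_div_le_one_div_of_le (by positivity) (by linarith)

theorem rightCF_le_wordVal_cons (ha : ∀ i, 1 ≤ a i ∧ a i ≤ 4) (hv : ∀ e ∈ d :: v, 1 ≤ e)
    (h : a (n + 1) = d) (hle : wordVal v ≤ rightCF a (n + 1)) : rightCF a n ≤ wordVal (d :: v) := by
  have hv' : ∀ e ∈ v, 1 ≤ e := fun e he => hv e (List.mem_cons_of_mem _ he)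
  have hd : (1 : ℝ) ≤ d := by exact_mod_cast hv d List.mem_cons_self
  rw [rightCF_step fun i => (ha i).1, wordVal_cons hv, h]
  have h1 := wordVal_nonneg hv'
  exact one_div_le_one_div_of_le (by linarith) (by linarith)

theorem wordVal_cons_le_rightCF (ha : ∀ i, 1 ≤ a i ∧ a i ≤ 4) (hv : ∀ e ∈ d :: v, 1 ≤ e)
    (h : a (n + 1) = d) (hle : rightCF a (n + 1) ≤ wordVal v) : wordVal (d :: v) ≤ rightCF a n := by
  have hd : (1 : ℝ) ≤ d := by exact_mod_cast hv d List.mem_cons_self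
  rw [rightCF_step fun i => (ha i).1, wordVal_cons hv, h]
  have h3 := rightCF_pos (fun i => (ha i).1) (n + 1)
  exact one_div_le_one_div_of_le (by linarith) (by linarith)

end compare

namespace Branch
variable {q ε : ℝ} {N : ℕ} {a a' : ℤ → ℕ} {n : ℤ}

theorem mem_uIcc_of_le {x y z : ℝ} (h1 : y ≤ x) (h2 : x ≤ z) : x ∈ Set.uIcc y z :=
  Set.mem_uIcc.2 (Or.inl ⟨h1, h2⟩)

theorem mem_uIcc_of_ge {x y z : ℝ} (h1 : z ≤ x) (h2 : x ≤ y) : x ∈ Set.uIcc y z :=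
  Set.mem_uIcc.2 (Or.inr ⟨h1, h2⟩)

theorem bound' (h : Branch q ε N a a' n) : 559 / 125 ≤ q + ε := by
  have := h.bound
  have : 0 ≤ ε := le_trans (by positivity) h.err
  linarith

theorem past (h : Branch q ε N a a' n) : 1 / 5 ≤ leftCF a (n + 1) ∧ leftCF a (n + 1) ≤ 5 / 6 :=
  leftCF_bounds h.digits _

theorem past_of_ge (h : Branch q ε N a a' n) {d : ℕ} (hd : 1 ≤ d) (hn : d ≤ a n) :
    leftCF a (n + 1) ≤ 1 / d := by
  rw [leftCF_step fun i => (h.digits i).1, add_sub_cancel_right]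
  have := leftCF_pos (fun i => (h.digits i).1) n
  have h1 : (d : ℝ) ≤ a n := by exact_mod_cast hn
  have h2 : (1 : ℝ) ≤ d := by exact_mod_cast hd
  exact one_div_le_one_div_of_le (by linarith) (by linarith)

theorem next_ne_four (h : Branch q ε N a a' n) {i : ℤ} (hi : a i ≤ 2) : a (i + 1) ≠ 4 := by
  intro h4
  have := ((h.left.admissible (i + 1)).2.2 h4).2
  rw [add_sub_cancel_right] at this
  omega

theorem three_le_of_next (h : Branch q ε N a a' n) {i : ℤ} (hi : a (i + 1) = 4) : 3 ≤ a i := by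
  by_contra! hlt
  exact h.next_ne_four (by omega) hi

/-- Two isolated sequences that branch have adjacent next digits. -/
theorem succ_digit (h : Branch q ε N a a' n) (hlt : a (n + 1) < a' (n + 1)) :
    a' (n + 1) = a (n + 1) + 1 := by
  have hda := h.digits
  have hda' := h.symm.digits
  have hb := h.bound'
  obtain ⟨hz1, hz2⟩ := h.past
  by_contra hne
  have h1 := (hda (n + 1)).1
  have h2 := (hda' (n + 1)).2
  have htn := wordVal_nil
  rcases Nat.lt_or_ge (a (n + 1)) 2 with h3 | h3
  · refine h.false_of_between (v := [2]) (by simp) ?_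
      (mem_uIcc_of_ge (rightCF_le_wordVal_of_lt hda' (by simp) (by omega))
        (wordVal_le_rightCF_of_lt hda (by simp) (by omega)))
    simp [Fits]
  · refine h.false_of_between (v := [3]) (by simp) ?_
      (mem_uIcc_of_ge (rightCF_le_wordVal_of_lt hda' (by simp) (by omega))
        (wordVal_le_rightCF_of_lt hda (by simp) (by omega)))
    simp only [Fits, Nat.cast_ofNat, and_true]
    intro _
    linarith

/-- Branches with next digits `1` and `2`. -/
theorem digits_one_two (h : Branch q ε N a a' n) (h1 : a (n + 1) = 1) (h2 : a' (n + 1) = 2) :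
    (a (n + 1 + 1) = 1 ∧ a (n + 1 + 1 + 1) = 3) ∧ a' (n + 1 + 1) = 3 := by
  have hda := h.digits
  have hda' := h.symm.digits
  have hb := h.bound'
  obtain ⟨hz1, hz2⟩ := h.past
  have htn := wordVal_nil
  have e2 : a (n + 1 + 1) = 1 := by
    by_contra hne
    have := (hda (n + 1 + 1)).1
    refine h.false_of_between (v := [1, 1]) (by simp) ?_
      (mem_uIcc_of_ge (rightCF_le_wordVal_of_lt hda' (by simp) (by omega))
        (wordVal_cons_le_rightCF hda (by simp) h1 (rightCF_le_wordVal_of_lt hda (by simp) (by omega))))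
    simp [Fits]
  refine ⟨⟨e2, ?_⟩, ?_⟩
  · by_contra hne
    have := (hda (n + 1 + 1 + 1)).1
    have := (hda (n + 1 + 1 + 1)).2
    have := h.next_ne_four (i := n + 1 + 1) (by omega)
    refine h.false_of_between (v := [1, 1, 3]) (by simp) ?_
      (mem_uIcc_of_ge (rightCF_le_wordVal_of_lt hda' (by simp) (by omega))
        (wordVal_cons_le_rightCF hda (by simp) h1 (rightCF_le_wordVal_cons hda (by simp) e2
          (wordVal_le_rightCF_of_lt hda (by simp) (by omega)))))
    have k1 := one_div_mem (d := 1) (by norm_num) hz1 hz2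
    have k2 := one_div_mem (d := 1) (by norm_num) k1.1 k1.2
    norm_num at k2
    norm_num [Fits]
    linarith
  · by_contra hne
    have := (hda' (n + 1 + 1)).1
    have := (hda' (n + 1 + 1)).2
    have := h.symm.next_ne_four (i := n + 1) (by omega)
    refine h.false_of_between (v := [2, 3]) (by simp) ?_
      (mem_uIcc_of_ge (rightCF_le_wordVal_cons hda' (by simp) h2
          (wordVal_le_rightCF_of_lt hda' (by simp) (by omega)))
        (wordVal_le_rightCF_of_lt hda (by simp) (by omega)))
    have k1 := one_div_mem (d := 2) (by norm_num) hz1 hz2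
    norm_num at k1
    norm_num [Fits]
    linarith

/-- Branches with next digits `3` and `4`. -/
theorem digits_three_four (h : Branch q ε N a a' n) (h1 : a (n + 1) = 3) (h2 : a' (n + 1) = 4) :
    a (n + 1 + 1) = 1 ∧ a (n + 1 + 1 + 1) = 3 ∧ a (n + 1 + 1 + 1 + 1) = 1 := by
  have hda := h.digits
  have hda' := h.symm.digits
  have hb := h.bound'
  have hn3 : 3 ≤ a n := by
    rw [h.agree n (by have := h.le; omega) le_rfl]
    exact h.symm.three_le_of_next h2
  have hz1 := h.past.1
  have hz2 := h.past_of_ge (by norm_num) hn3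
  have htn := wordVal_nil
  have t1 := one_div_mem (d := 1) (by norm_num) htn.1 htn.2
  have t2 := one_div_mem (d := 2) (by norm_num) htn.1 htn.2
  have t3 := one_div_mem (d := 3) (by norm_num) htn.1 htn.2
  have t13 := one_div_mem (d := 1) (by norm_num) t3.1 t3.2
  have t11 := one_div_mem (d := 1) (by norm_num) t1.1 t1.2
  have t311 := one_div_mem (d := 3) (by norm_num) (one_div_mem (d := 1) (by norm_num) t1.1 t1.2).1
    (one_div_mem (d := 1) (by norm_num) t1.1 t1.2).2
  have t1311 := one_div_mem (d := 1) (by norm_num) t311.1 t311.2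
  have k3 := one_div_mem (d := 3) (by norm_num) hz1 hz2
  have k31 := one_div_mem (d := 1) (by norm_num) k3.1 k3.2
  norm_num at t1 t2 t3 t13 t11 t311 t1311 k3 k31 hz2
  have e2 : a (n + 1 + 1) = 1 := by
    by_contra hne
    have := (hda (n + 1 + 1)).1
    refine h.false_of_between (v := [3, 1]) (by simp) ?_
      (mem_uIcc_of_ge (rightCF_le_wordVal_of_lt hda' (by simp) (by omega))
        (wordVal_cons_le_rightCF hda (by simp) h1 (rightCF_le_wordVal_of_lt hda (by simp) (by omega))))
    norm_num [Fits, wordVal_cons]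
    linarith
  have e3 : a (n + 1 + 1 + 1) = 3 := by
    by_contra hne
    have := (hda (n + 1 + 1 + 1)).1
    have := (hda (n + 1 + 1 + 1)).2
    have := h.next_ne_four (i := n + 1 + 1) (by omega)
    refine h.false_of_between (v := [3, 1, 3]) (by simp) ?_
      (mem_uIcc_of_ge (rightCF_le_wordVal_of_lt hda' (by simp) (by omega))
        (wordVal_cons_le_rightCF hda (by simp) h1 (rightCF_le_wordVal_cons hda (by simp) e2
          (wordVal_le_rightCF_of_lt hda (by simp) (by omega)))))
    norm_num [Fits, wordVal_cons]
    constructor <;> linarith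
  refine ⟨e2, e3, ?_⟩
  by_contra hne
  have := (hda (n + 1 + 1 + 1 + 1)).1
  refine h.false_of_between (v := [3, 1, 3, 1, 1]) (by simp) ?_
    (mem_uIcc_of_ge (rightCF_le_wordVal_of_lt hda' (by simp) (by omega))
      (wordVal_cons_le_rightCF hda (by simp) h1 (rightCF_le_wordVal_cons hda (by simp) e2
        (wordVal_cons_le_rightCF hda (by simp) e3
          (rightCF_le_wordVal_of_lt hda (by simp) (by omega))))))
  norm_num [Fits, wordVal_cons]
  constructor <;> linarith

/-- Branches with next digits `2` and `3`. -/
theorem digits_two_three (h : Branch q ε N a a' n) (h1 : a (n + 1) = 2) (h2 : a' (n + 1) = 3) :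
    (a (n + 1 + 1) = 1 ∧ a (n + 1 + 1 + 1) = 3 ∧ a (n + 1 + 1 + 1 + 1) = 1) ∧
      3 ≤ a' (n + 1 + 1) := by
  have hda := h.digits
  have hda' := h.symm.digits
  have hb := h.bound'
  obtain ⟨hz1, hz2⟩ := h.past
  have htn := wordVal_nil
  have t1 := one_div_mem (d := 1) (by norm_num) htn.1 htn.2
  have t3 := one_div_mem (d := 3) (by norm_num) htn.1 htn.2
  have t11 := one_div_mem (d := 1) (by norm_num) t1.1 t1.2
  have k2 := one_div_mem (d := 2) (by norm_num) hz1 hz2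
  have k3 := one_div_mem (d := 3) (by norm_num) hz1 hz2
  have k21 := one_div_mem (d := 1) (by norm_num) k2.1 k2.2
  norm_num at t1 t3 t11 k2 k21 k3
  have e2 : a (n + 1 + 1) = 1 := by
    by_contra hne
    have := (hda (n + 1 + 1)).1
    refine h.false_of_between (v := [2, 1]) (by simp) ?_
      (mem_uIcc_of_ge (rightCF_le_wordVal_of_lt hda' (by simp) (by omega))
        (wordVal_cons_le_rightCF hda (by simp) h1 (rightCF_le_wordVal_of_lt hda (by simp) (by omega))))
    norm_num [Fits]
  have e3 : a (n + 1 + 1 + 1) = 3 := by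
    by_contra hne
    have := (hda (n + 1 + 1 + 1)).1
    have := (hda (n + 1 + 1 + 1)).2
    have := h.next_ne_four (i := n + 1 + 1) (by omega)
    refine h.false_of_between (v := [2, 1, 3]) (by simp) ?_
      (mem_uIcc_of_ge (rightCF_le_wordVal_of_lt hda' (by simp) (by omega))
        (wordVal_cons_le_rightCF hda (by simp) h1 (rightCF_le_wordVal_cons hda (by simp) e2
          (wordVal_le_rightCF_of_lt hda (by simp) (by omega)))))
    norm_num [Fits, wordVal_cons]
    linarith
  refine ⟨⟨e2, e3, ?_⟩, ?_⟩
  · by_contra hne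
    have := (hda (n + 1 + 1 + 1 + 1)).1
    refine h.false_of_between (v := [2, 1, 3, 1, 1]) (by simp) ?_
      (mem_uIcc_of_ge (rightCF_le_wordVal_of_lt hda' (by simp) (by omega))
        (wordVal_cons_le_rightCF hda (by simp) h1 (rightCF_le_wordVal_cons hda (by simp) e2
          (wordVal_cons_le_rightCF hda (by simp) e3
            (rightCF_le_wordVal_of_lt hda (by simp) (by omega))))))
    norm_num [Fits, wordVal_cons]
    linarith
  · by_contra! hlt
    refine h.false_of_between (v := [3, 3]) (by simp) ?_
      (mem_uIcc_of_ge (rightCF_le_wordVal_cons hda' (by simp) h2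
          (wordVal_le_rightCF_of_lt hda' (by simp) (by omega)))
        (wordVal_le_rightCF_of_lt hda (by simp) (by omega)))
    norm_num [Fits, wordVal_cons]
    constructor <;> linarith

/-- Branches with next digits `2` and `34` after a digit other than `1`. -/
theorem digits_two_three_four (h : Branch q ε N a a' n) (h1 : a (n + 1) = 2) (h2 : a' (n + 1) = 3)
    (h3 : a' (n + 1 + 1) = 4) (hn : 2 ≤ a n) : a (n + 1 + 1 + 1 + 1 + 1) = 3 := by
  have hda := h.digits
  have hda' := h.symm.digits
  have hn' : 2 ≤ a' n := by rwa [← h.agree n (by have := h.le; omega) le_rfl]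
  have hε : 0 ≤ ε := le_trans (by positivity) h.err
  obtain ⟨⟨e2, e3, e4⟩, -⟩ := h.digits_two_three h1 h2
  by_contra hne
  have := (hda (n + 1 + 1 + 1 + 1 + 1)).1
  have := (hda (n + 1 + 1 + 1 + 1 + 1)).2
  have := h.next_ne_four (i := n + 1 + 1 + 1 + 1) (by omega)
  have hz1 := h.symm.past.1
  have hz2 := h.symm.past_of_ge (by norm_num) hn'
  push_cast at hz2
  have htn := wordVal_nil
  have t3 := one_div_mem (d := 3) (by norm_num) htn.1 htn.2
  have t13 := one_div_mem (d := 1) (by norm_num) t3.1 t3.2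
  have k3 := one_div_mem (d := 3) (by norm_num) hz1 hz2
  have k2 := one_div_mem (d := 2) (by norm_num) hz1 hz2
  have k21 := one_div_mem (d := 1) (by norm_num) k2.1 k2.2
  have k213 := one_div_mem (d := 3) (by norm_num) k21.1 k21.2
  have k2131 := one_div_mem (d := 1) (by norm_num) k213.1 k213.2
  norm_num at t3 t13 k2 k21 k213 k2131 k3
  refine h.symm.false_of_between (v := [2, 1, 3, 1, 3]) (by simp) ?_
    (mem_uIcc_of_le (rightCF_le_wordVal_of_lt hda' (by simp) (by omega))
      (wordVal_cons_le_rightCF hda (by simp) h1 (rightCF_le_wordVal_cons hda (by simp) e2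
        (wordVal_cons_le_rightCF hda (by simp) e3 (rightCF_le_wordVal_cons hda (by simp) e4
          (wordVal_le_rightCF_of_lt hda (by simp) (by omega)))))))
  have hq := h.right.markovVal_le (n + 1 + 1)
  have hL : leftCF a' (n + 1 + 1) = 1 / (3 + leftCF a' (n + 1)) := by
    rw [leftCF_step fun i => (hda' i).1, add_sub_cancel_right, h2]; norm_num
  have hR : 3 / 13 ≤ rightCF a' (n + 1 + 1) := by
    have ha1 : ∀ i, 1 ≤ a' i := fun i => (hda' i).1
    rw [rightCF_step ha1]
    have hp := rightCF_pos ha1 (n + 1 + 1 + 1)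
    have hlt := rightCF_lt_one ha1 (n + 1 + 1 + 1)
    rw [le_div_iff₀ (by positivity)]
    rcases (hda' (n + 1 + 1 + 1)).2.lt_or_eq with h4 | h4
    · have : (a' (n + 1 + 1 + 1) : ℝ) ≤ 3 := by exact_mod_cast Nat.lt_succ_iff.1 h4
      linarith
    · have h5 : rightCF a' (n + 1 + 1 + 1) ≤ 1 / 3 := by
        rw [rightCF_step ha1]
        have := rightCF_pos ha1 (n + 1 + 1 + 1 + 1)
        have : (3 : ℝ) ≤ a' (n + 1 + 1 + 1 + 1) := by
          exact_mod_cast ((h.right.admissible _).2.2 h4).1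
        exact one_div_le_one_div_of_le (by norm_num) (by linarith)
      rw [h4]; push_cast; linarith
  have hid : 1 / (1 + 1 / (2 + leftCF a' (n + 1))) = 1 - 1 / (3 + leftCF a' (n + 1)) := by
    field_simp; ring
  rw [markovVal, h3, hL] at hq
  push_cast at hq
  norm_num at hid
  norm_num at hq
  norm_num [Fits, wordVal_cons]
  have := h.bound'
  constructor <;> linarith

end Branch

/-- The weight of the cylinder of the first `n` digits of `γ`. -/
noncomputable def cylWeight (s : ℝ) (γ : ℕ → ℕ) (n : ℕ) : ℝ :=
  (1 / (contDen γ (n + 1) : ℝ) ^ 2) ^ s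

theorem cylWeight_nonneg (s : ℝ) (γ : ℕ → ℕ) (n : ℕ) : 0 ≤ cylWeight s γ n :=
  Real.rpow_nonneg (by positivity) _

/-- The elements of `S` that agree with `γ` on the first `n` digits and satisfy `P` are covered by
finitely many longer cylinders with total weight at most `c` times that of `γ`. -/
def Covered (S : Set (ℕ → ℕ)) (s : ℝ) (γ : ℕ → ℕ) (n : ℕ) (P : (ℕ → ℕ) → Prop) (c : ℝ) : Prop :=
  ∃ l : List ((ℕ → ℕ) × ℕ), (∀ p ∈ l, p.1 ∈ S ∧ n < p.2) ∧
    (∀ δ ∈ S, (∀ k < n, δ k = γ k) → P δ → ∃ p ∈ l, ∀ k < p.2, δ k = p.1 k) ∧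
    (l.map fun p => cylWeight s p.1 p.2).sum ≤ c * cylWeight s γ n

theorem Covered.or {S : Set (ℕ → ℕ)} {s : ℝ} {γ : ℕ → ℕ} {n : ℕ} {P P' : (ℕ → ℕ) → Prop} {c c' : ℝ}
    (h : Covered S s γ n P c) (h' : Covered S s γ n P' c') :
    Covered S s γ n (fun δ => P δ ∨ P' δ) (c + c') := by
  obtain ⟨l, h1, h2, h3⟩ := h
  obtain ⟨l', h1', h2', h3'⟩ := h'
  refine ⟨l ++ l', ?_, ?_, ?_⟩
  · intro p hp
    rcases List.mem_append.1 hp with hp | hp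
    · exact h1 p hp
    · exact h1' p hp
  · rintro δ hδ hag (hP | hP)
    · obtain ⟨p, hp, hp2⟩ := h2 δ hδ hag hP
      exact ⟨p, List.mem_append_left _ hp, hp2⟩
    · obtain ⟨p, hp, hp2⟩ := h2' δ hδ hag hP
      exact ⟨p, List.mem_append_right _ hp, hp2⟩
  · rw [List.map_append, List.sum_append, add_mul]
    exact add_le_add h3 h3'

theorem Covered.mono {S : Set (ℕ → ℕ)} {s : ℝ} {γ : ℕ → ℕ} {n : ℕ} {P P' : (ℕ → ℕ) → Prop} {c c' : ℝ}
    (h : Covered S s γ n P c) (hP : ∀ δ ∈ S, (∀ k < n, δ k = γ k) → P' δ → P δ) (hc : c ≤ c') :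
    Covered S s γ n P' c' := by
  obtain ⟨l, h1, h2, h3⟩ := h
  exact ⟨l, h1, fun δ hδ hag hP' => h2 δ hδ hag (hP δ hδ hag hP'),
    h3.trans (mul_le_mul_of_nonneg_right hc (cylWeight_nonneg _ _ _))⟩

theorem exists_cover_of_covered {S : Set (ℕ → ℕ)} {s : ℝ} {n₀ : ℕ} {γ₀ : ℕ → ℕ} (hγ₀ : γ₀ ∈ S)
    (hag : ∀ δ ∈ S, ∀ k < n₀, δ k = γ₀ k)
    (H : ∀ γ ∈ S, ∀ n, n₀ ≤ n → Covered S s γ n (fun _ => True) 1) (k : ℕ) :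
    ∃ l : List ((ℕ → ℕ) × ℕ), (∀ p ∈ l, p.1 ∈ S ∧ n₀ + k ≤ p.2) ∧
      (∀ δ ∈ S, ∃ p ∈ l, ∀ k < p.2, δ k = p.1 k) ∧
      (l.map fun p => cylWeight s p.1 p.2).sum ≤ cylWeight s γ₀ n₀ := by
  induction k with
  | zero => exact ⟨[(γ₀, n₀)], by simpa using hγ₀, fun δ hδ => ⟨_, List.mem_singleton_self _, hag δ hδ⟩, by simp⟩
  | succ k ih =>
    obtain ⟨l, h1, h2, h3⟩ := ih
    have hex : ∀ p : (ℕ → ℕ) × ℕ, ∃ l' : List ((ℕ → ℕ) × ℕ), p ∈ l →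
        (∀ r ∈ l', r.1 ∈ S ∧ p.2 < r.2) ∧
        (∀ δ ∈ S, (∀ k < p.2, δ k = p.1 k) → ∃ r ∈ l', ∀ k < r.2, δ k = r.1 k) ∧
        (l'.map fun r => cylWeight s r.1 r.2).sum ≤ cylWeight s p.1 p.2 := by
      intro p
      by_cases hp : p ∈ l
      · obtain ⟨l', g1, g2, g3⟩ := H p.1 (h1 p hp).1 p.2 (by have := (h1 p hp).2; omega)
        exact ⟨l', fun _ => ⟨g1, fun δ hδ h => g2 δ hδ h trivial, by simpa using g3⟩⟩
      · exact ⟨[], fun h => absurd h hp⟩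
    choose f hf using hex
    refine ⟨l.flatMap f, ?_, ?_, ?_⟩
    · intro r hr
      obtain ⟨p, hp, hr⟩ := List.mem_flatMap.1 hr
      have g1 := (hf p hp).1 r hr
      have g2 := (h1 p hp).2
      exact ⟨g1.1, by omega⟩
    · intro δ hδ
      obtain ⟨p, hp, hp2⟩ := h2 δ hδ
      obtain ⟨r, hr, hr2⟩ := (hf p hp).2.1 δ hδ hp2
      exact ⟨r, List.mem_flatMap.2 ⟨p, hp, hr⟩, hr2⟩
    · refine le_trans ?_ h3
      clear h1 h2 h3
      induction l with
      | nil => simp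
      | cons p l ih =>
        simp only [List.flatMap_cons, List.map_append, List.sum_append, List.map_cons, List.sum_cons]
        exact add_le_add (hf p List.mem_cons_self).2.2
          (ih fun p hp => hf p (List.mem_cons_of_mem _ hp))

theorem dimH_image_cfVal_le {S : Set (ℕ → ℕ)} (hS : ∀ γ ∈ S, ∀ n, 1 ≤ γ n) {n₀ : ℕ} {s : NNReal}
    (hag : ∀ γ ∈ S, ∀ δ ∈ S, ∀ k < n₀, γ k = δ k)
    (H : ∀ γ ∈ S, ∀ n, n₀ ≤ n → Covered S s γ n (fun _ => True) 1) :
    dimH (cfVal '' S) ≤ s := by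
  rcases S.eq_empty_or_nonempty with rfl | ⟨γ₀, hγ₀⟩
  · simp
  choose l hl1 hl2 hl3 using exists_cover_of_covered hγ₀ (fun δ hδ => hag δ hδ γ₀ hγ₀) H
  have hdiam : ∀ (k : ℕ) (i : Fin (l k).length),
      Metric.ediam (cfVal '' {δ ∈ S | ∀ j < ((l k).get i).2, δ j = ((l k).get i).1 j}) ≤
        ENNReal.ofReal (1 / (contDen ((l k).get i).1 (((l k).get i).2 + 1) : ℝ) ^ 2) := by
    intro k i
    apply Metric.ediam_le
    rintro _ ⟨δ, ⟨hδ, hδa⟩, rfl⟩ _ ⟨δ', ⟨hδ', hδa'⟩, rfl⟩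
    rw [edist_dist, Real.dist_eq]
    apply ENNReal.ofReal_le_ofReal
    rw [← contDen_congr hδa _ le_rfl]
    exact abs_cfVal_sub_le_den (hS δ hδ) (hS δ' hδ') fun j hj => (hδa j hj).trans (hδa' j hj).symm
  have hmeas : MeasureTheory.Measure.hausdorffMeasure (s : ℝ) (cfVal '' S) ≤
      ENNReal.ofReal (cylWeight s γ₀ n₀) := by
    refine (MeasureTheory.Measure.hausdorffMeasure_le_liminf_sum (s : ℝ) (cfVal '' S)
      (l := Filter.atTop) (ι := fun k => Fin (l k).length)
      (fun k : ℕ => ENNReal.ofReal (2 / ((k : ℝ) + 1))) ?_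
      (fun k i => cfVal '' {δ ∈ S | ∀ j < ((l k).get i).2, δ j = ((l k).get i).1 j}) ?_ ?_).trans ?_
    · have := ENNReal.tendsto_ofReal two_div_succ_tendsto
      rwa [ENNReal.ofReal_zero] at this
    · refine Filter.Eventually.of_forall fun k i => (hdiam k i).trans (ENNReal.ofReal_le_ofReal ?_)
      have h1 := hl1 k _ ((l k).get_mem i)
      refine (one_div_contDen_sq_le (hS _ h1.1) _).trans ?_
      have : (k : ℝ) ≤ (((l k).get i).2 : ℝ) := by exact_mod_cast (by omega : k ≤ ((l k).get i).2)
      gcongr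
    · refine Filter.Eventually.of_forall fun k => ?_
      rintro _ ⟨δ, hδ, rfl⟩
      obtain ⟨p, hp, hp2⟩ := hl2 k δ hδ
      obtain ⟨i, hi⟩ := List.get_of_mem hp
      refine Set.mem_iUnion.2 ⟨i, δ, ⟨hδ, ?_⟩, rfl⟩
      rw [hi]; exact hp2
    · refine Filter.liminf_le_of_le (by isBoundedDefault) fun b hb => ?_
      obtain ⟨k, hk⟩ := hb.exists
      refine hk.trans ?_
      calc _ ≤ ∑ i : Fin (l k).length, ENNReal.ofReal
              (cylWeight s ((l k).get i).1 ((l k).get i).2) := by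
            refine Finset.sum_le_sum fun i _ => ?_
            rw [cylWeight, ← ENNReal.ofReal_rpow_of_nonneg (by positivity) s.coe_nonneg]
            exact ENNReal.rpow_le_rpow (hdiam k i) s.coe_nonneg
        _ = ENNReal.ofReal (∑ i : Fin (l k).length, cylWeight s ((l k).get i).1 ((l k).get i).2) :=
            (ENNReal.ofReal_sum_of_nonneg fun i _ => cylWeight_nonneg _ _ _).symm
        _ ≤ _ := by
            apply ENNReal.ofReal_le_ofReal
            refine le_of_eq_of_le ?_ (hl3 k)
            rw [← List.sum_ofFn]
            congr 1
            have e := List.map_ofFn (f := (l k).get) (g := fun p => cylWeight s p.1 p.2)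
            rw [List.ofFn_get] at e
            exact e.symm
  exact dimH_le_of_hausdorffMeasure_ne_top (ne_top_of_le_ne_top ENNReal.ofReal_ne_top hmeas)

/-- The word `u` stands in `γ` from position `n` on. -/
def Follows (γ : ℕ → ℕ) : ℕ → List ℕ → Prop
  | _, [] => True
  | n, d :: u => γ n = d ∧ Follows γ (n + 1) u

/-- The continuant after appending a word to a word with last continuants `x`, `y`. -/
def extendDen : List ℕ → ℕ → ℕ → ℕ
  | [], _, y => y
  | d :: u, x, y => extendDen u y (d * y + x)

theorem Follows.contDen_eq {γ : ℕ → ℕ} {n : ℕ} {u : List ℕ} (h : Follows γ n u) :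
    contDen γ (n + u.length + 1) = extendDen u (contDen γ n) (contDen γ (n + 1)) := by
  induction u generalizing n with
  | nil => rfl
  | cons d u ih =>
    rw [extendDen, ← h.1, List.length_cons, show n + (u.length + 1) + 1 = n + 1 + u.length + 1 by omega,
      ih h.2]
    rfl

theorem Follows.agree {γ δ : ℕ → ℕ} {n : ℕ} {u : List ℕ} (h : Follows γ n u) (h' : Follows δ n u)
    (hag : ∀ k < n, γ k = δ k) : ∀ k < n + u.length, γ k = δ k := by
  induction u generalizing n with
  | nil => simpa using hag
  | cons d u ih =>
    intro k hk
    refine ih h.2 h'.2 (fun j hj => ?_) k (by rw [List.length_cons] at hk; omega)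
    rcases Nat.lt_succ_iff_lt_or_eq.1 hj with hj | rfl
    · exact hag j hj
    · exact h.1.trans h'.1.symm

theorem inv_sq_rpow_le {t c x y : ℝ} (hx : 0 < x) (ht : 0 < t) (hc : 0 ≤ c) (hxy : t * x ≤ y)
    (htc : 1 ≤ t ^ 10 * c ^ 29) :
    (1 / y ^ 2) ^ (5 / 29 : ℝ) ≤ c * (1 / x ^ 2) ^ (5 / 29 : ℝ) := by
  have h1 : 1 / y ^ 2 ≤ 1 / t ^ 2 * (1 / x ^ 2) := by
    rw [one_div_mul_one_div, ← mul_pow]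
    apply one_div_le_one_div_of_le (by positivity)
    gcongr
  have h2 : (1 / t ^ 2) ^ (5 / 29 : ℝ) ≤ c := by
    have e : (1 / t ^ 2) ^ (5 / 29 : ℝ) = ((1 / t ^ 2) ^ 5) ^ ((29 : ℕ) : ℝ)⁻¹ := by
      rw [← Real.rpow_natCast (1 / t ^ 2) 5, ← Real.rpow_mul (by positivity)]
      norm_num
    rw [e, ← Real.pow_rpow_inv_natCast hc (n := 29) (by norm_num)]
    apply Real.rpow_le_rpow (by positivity) _ (by positivity)
    rw [one_div, inv_pow, ← pow_mul, inv_le_iff_one_le_mul₀ (by positivity)]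
    norm_num
    rwa [mul_comm] at htc
  calc (1 / y ^ 2) ^ (5 / 29 : ℝ) ≤ (1 / t ^ 2 * (1 / x ^ 2)) ^ (5 / 29 : ℝ) :=
        Real.rpow_le_rpow (by positivity) h1 (by norm_num)
    _ = (1 / t ^ 2) ^ (5 / 29 : ℝ) * (1 / x ^ 2) ^ (5 / 29 : ℝ) :=
        Real.mul_rpow (by positivity) (by positivity)
    _ ≤ _ := by gcongr

theorem covered_of_follows {S : Set (ℕ → ℕ)} (hS : ∀ γ ∈ S, ∀ n, 1 ≤ γ n) {γ : ℕ → ℕ} (hγ : γ ∈ S)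
    {n : ℕ} {P : (ℕ → ℕ) → Prop} {u : List ℕ} (hu : u ≠ [])
    (hP : ∀ δ ∈ S, (∀ k < n, δ k = γ k) → P δ → Follows δ n u) {t c : ℝ} (ht : 0 < t) (hc : 0 ≤ c)
    (hden : t * contDen γ (n + 1) ≤ extendDen u (contDen γ n) (contDen γ (n + 1)))
    (htc : 1 ≤ t ^ 10 * c ^ 29) :
    Covered S (5 / 29 : ℝ) γ n P c := by
  by_cases hex : ∃ δ ∈ S, (∀ k < n, δ k = γ k) ∧ P δ
  · obtain ⟨δ, hδ, hag, hPδ⟩ := hex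
    have hf := hP δ hδ hag hPδ
    have hlen : 0 < u.length := List.length_pos_iff.2 hu
    refine ⟨[(δ, n + u.length)], ?_, ?_, ?_⟩
    · simp only [List.mem_singleton, forall_eq]
      exact ⟨hδ, by omega⟩
    · intro δ' hδ' hag' hPδ'
      refine ⟨_, List.mem_singleton_self _, ?_⟩
      exact (hP δ' hδ' hag' hPδ').agree hf fun k hk => (hag' k hk).trans (hag k hk).symm
    · simp only [List.map_cons, List.map_nil, List.sum_cons, List.sum_nil, add_zero, cylWeight]
      apply inv_sq_rpow_le (by exact_mod_cast contDen_succ_pos (hS γ hγ) n) ht hc _ htc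
      rw [hf.contDen_eq, contDen_congr hag n (by omega), contDen_congr hag (n + 1) le_rfl]
      exact hden
  · refine ⟨[], by simp, fun δ hδ hag hPδ => absurd ⟨δ, hδ, hag, hPδ⟩ hex, ?_⟩
    simp only [List.map_nil, List.sum_nil]
    exact mul_nonneg hc (cylWeight_nonneg _ _ _)

/-- The right halves of the isolated sequences with prescribed central digits `w`. -/
def isolatedTails (q ε : ℝ) (N : ℕ) (w : Fin (2 * N + 1) → ℕ) : Set (ℕ → ℕ) :=
  {δ | ∃ a : ℤ → ℕ, Isolated q ε N a ∧ (∀ j : Fin (2 * N + 1), a ((j : ℕ) - N) = w j) ∧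
    ∀ k : ℕ, δ k = a (k + 1)}

section tails
variable {q ε : ℝ} {N : ℕ} {w : Fin (2 * N + 1) → ℕ}

theorem isolatedTails_digits {δ : ℕ → ℕ} (h : δ ∈ isolatedTails q ε N w) (k : ℕ) :
    1 ≤ δ k ∧ δ k ≤ 4 := by
  obtain ⟨a, ha, -, hδ⟩ := h
  rw [hδ]; exact ⟨(ha.admissible _).1, (ha.admissible _).2.1⟩

theorem exists_branch (hq : 559 / 125 ≤ q) (herr : 2 / ((N : ℝ) + 1) ≤ ε) {δ δ' : ℕ → ℕ}
    (h : δ ∈ isolatedTails q ε N w) (h' : δ' ∈ isolatedTails q ε N w) {n : ℕ} (hn : N ≤ n)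
    (hag : ∀ k < n, δ k = δ' k) :
    ∃ a a' : ℤ → ℕ, Branch q ε N a a' n ∧ (∀ k : ℕ, δ k = a (k + 1)) ∧ ∀ k : ℕ, δ' k = a' (k + 1) := by
  obtain ⟨a, ha, haw, hδ⟩ := h
  obtain ⟨a', ha', haw', hδ'⟩ := h'
  refine ⟨a, a', ⟨ha, ha', fun i h1 h2 => ?_, by exact_mod_cast hn, herr, hq⟩, hδ, hδ'⟩
  rcases le_or_gt i N with h3 | h3
  · have e : (((i + N).toNat : ℕ) : ℤ) - N = i := by omega
    have g := (haw ⟨(i + N).toNat, by omega⟩).trans (haw' ⟨(i + N).toNat, by omega⟩).symm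
    simpa only [e] using g
  · have := hag (i - 1).toNat (by omega)
    rw [hδ, hδ', show (((i - 1).toNat : ℕ) : ℤ) + 1 = i by omega] at this
    exact this

theorem tails_succ_digit (hq : 559 / 125 ≤ q) (herr : 2 / ((N : ℝ) + 1) ≤ ε) {δ δ' : ℕ → ℕ}
    (h : δ ∈ isolatedTails q ε N w) (h' : δ' ∈ isolatedTails q ε N w) {n : ℕ} (hn : N ≤ n)
    (hag : ∀ k < n, δ k = δ' k)
    (hlt : δ n < δ' n) : δ' n = δ n + 1 := by
  obtain ⟨a, a', hb, hδ, hδ'⟩ := exists_branch hq herr h h' hn hag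
  rw [hδ, hδ'] at *
  exact hb.succ_digit hlt

theorem tails_one_two (hq : 559 / 125 ≤ q) (herr : 2 / ((N : ℝ) + 1) ≤ ε) {δ δ' : ℕ → ℕ}
    (h : δ ∈ isolatedTails q ε N w) (h' : δ' ∈ isolatedTails q ε N w) {n : ℕ} (hn : N ≤ n)
    (hag : ∀ k < n, δ k = δ' k)
    (h1 : δ n = 1) (h2 : δ' n = 2) :
    Follows δ n [1, 1, 3] ∧ Follows δ' n [2, 3] := by
  obtain ⟨a, a', hb, hδ, hδ'⟩ := exists_branch hq herr h h' hn hag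
  simp only [Follows, hδ, hδ', and_true, Nat.cast_succ] at *
  exact ⟨⟨h1, (hb.digits_one_two h1 h2).1⟩, h2, (hb.digits_one_two h1 h2).2⟩

theorem tails_three_four (hq : 559 / 125 ≤ q) (herr : 2 / ((N : ℝ) + 1) ≤ ε) {δ δ' : ℕ → ℕ}
    (h : δ ∈ isolatedTails q ε N w) (h' : δ' ∈ isolatedTails q ε N w) {n : ℕ} (hn : N ≤ n)
    (hag : ∀ k < n, δ k = δ' k)
    (h1 : δ n = 3) (h2 : δ' n = 4) : Follows δ n [3, 1, 3, 1] := by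
  obtain ⟨a, a', hb, hδ, hδ'⟩ := exists_branch hq herr h h' hn hag
  simp only [Follows, hδ, hδ', and_true, Nat.cast_succ] at *
  exact ⟨h1, hb.digits_three_four h1 h2⟩

theorem tails_two_three (hq : 559 / 125 ≤ q) (herr : 2 / ((N : ℝ) + 1) ≤ ε) {δ δ' : ℕ → ℕ}
    (h : δ ∈ isolatedTails q ε N w) (h' : δ' ∈ isolatedTails q ε N w) {n : ℕ} (hn : N ≤ n)
    (hag : ∀ k < n, δ k = δ' k)
    (h1 : δ n = 2) (h2 : δ' n = 3) :
    Follows δ n [2, 1, 3, 1] ∧ 3 ≤ δ' (n + 1) := by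
  obtain ⟨a, a', hb, hδ, hδ'⟩ := exists_branch hq herr h h' hn hag
  simp only [Follows, hδ, hδ', and_true, Nat.cast_succ] at *
  exact ⟨⟨h1, (hb.digits_two_three h1 h2).1⟩, (hb.digits_two_three h1 h2).2⟩

theorem tails_two_three_four (hq : 559 / 125 ≤ q) (herr : 2 / ((N : ℝ) + 1) ≤ ε) {δ δ' : ℕ → ℕ}
    (h : δ ∈ isolatedTails q ε N w) (h' : δ' ∈ isolatedTails q ε N w) {n : ℕ} (hn : N ≤ n)
    (hag : ∀ k < n, δ k = δ' k)
    (h1 : δ n = 2) (h2 : δ' n = 3) (h3 : δ' (n + 1) = 4) (hn1 : 1 ≤ n)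
    (hd : 2 ≤ δ (n - 1)) : Follows δ n [2, 1, 3, 1, 3] := by
  obtain ⟨a, a', hb, hδ, hδ'⟩ := exists_branch hq herr h h' hn hag
  have e : (((n - 1 : ℕ) : ℤ) + 1) = n := by omega
  rw [hδ, e] at hd
  simp only [Follows, hδ, hδ', and_true, Nat.cast_succ] at *
  obtain ⟨k1, k2, k3⟩ := (hb.digits_two_three h1 h2).1
  exact ⟨h1, k1, k2, k3, hb.digits_two_three_four h1 h2 h3 hd⟩

theorem contDen_le_five_mul {γ : ℕ → ℕ} (hγ : ∀ k, 1 ≤ γ k ∧ γ k ≤ 4) {n : ℕ} (hn : 2 ≤ n) :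
    contDen γ (n + 1) ≤ 5 * contDen γ n := by
  obtain ⟨m, rfl⟩ : ∃ m, n = m + 2 := ⟨n - 2, by omega⟩
  have h1 := Nat.mul_le_mul (hγ (m + 1)).2 (le_refl (contDen γ (m + 2)))
  have h2 := Nat.mul_le_mul (hγ m).1 (le_refl (contDen γ (m + 1)))
  have e1 : contDen γ (m + 2 + 1) = γ (m + 1) * contDen γ (m + 2) + contDen γ (m + 1) := rfl
  have e2 : contDen γ (m + 2) = γ m * contDen γ (m + 1) + contDen γ m := rfl
  omega

theorem contDen_of_last_one {γ : ℕ → ℕ} (hγ : ∀ k, 1 ≤ γ k ∧ γ k ≤ 4) {n : ℕ} (hn : 3 ≤ n)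
    (h1 : γ (n - 1) = 1) : 6 * contDen γ (n + 1) ≤ 11 * contDen γ n := by
  obtain ⟨m, rfl⟩ : ∃ m, n = m + 3 := ⟨n - 3, by omega⟩
  have h2 := Nat.mul_le_mul (hγ (m + 1)).1 (le_refl (contDen γ (m + 2)))
  have e0 : m + 3 - 1 = m + 2 := rfl
  rw [e0] at h1
  have e1 : contDen γ (m + 3 + 1) = γ (m + 2) * contDen γ (m + 3) + contDen γ (m + 2) := rfl
  have e2 : contDen γ (m + 3) = γ (m + 1) * contDen γ (m + 2) + contDen γ (m + 1) := rfl
  rw [h1, one_mul] at e1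
  have h5 : contDen γ (m + 2) ≤ 5 * contDen γ (m + 1) := by
    rcases m with _ | m
    · have e3 : contDen γ (0 + 2) = γ 0 * contDen γ 1 + contDen γ 0 := rfl
      have e4 : contDen γ 1 = 1 := rfl
      have e5 : contDen γ 0 = 0 := rfl
      have := (hγ 0).2
      rw [e4, e5] at e3
      simp only [zero_add] at *
      omega
    · exact contDen_le_five_mul hγ (n := m + 1 + 1) (by omega)
  omega

theorem covered_isolatedTails (hq : 559 / 125 ≤ q) (herr : 2 / ((N : ℝ) + 1) ≤ ε) (hN : 3 ≤ N)
    {γ : ℕ → ℕ} (hγ : γ ∈ isolatedTails q ε N w) {n : ℕ} (hn : N ≤ n) :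
    Covered (isolatedTails q ε N w) (5 / 29 : ℝ) γ n (fun _ => True) 1 := by
  set S := isolatedTails q ε N w with hS
  have hdig : ∀ δ ∈ S, ∀ k, 1 ≤ δ k ∧ δ k ≤ 4 := fun δ hδ => isolatedTails_digits hδ
  have hS1 : ∀ δ ∈ S, ∀ k, 1 ≤ δ k := fun δ hδ k => (hdig δ hδ k).1
  have hcl : ∀ {δ δ' : ℕ → ℕ}, (∀ k < n, δ k = γ k) → (∀ k < n, δ' k = γ k) →
      ∀ k < n, δ k = δ' k := fun h h' k hk => (h k hk).trans (h' k hk).symm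
  have h5 : (contDen γ (n + 1) : ℝ) ≤ 5 * contDen γ n := by
    exact_mod_cast contDen_le_five_mul (hdig γ hγ) (by omega)
  have hQ : (1 : ℝ) ≤ contDen γ (n + 1) := by exact_mod_cast contDen_succ_pos (hS1 γ hγ) n
  have cover : ∀ (P : (ℕ → ℕ) → Prop) (u : List ℕ) (t c : ℝ), u ≠ [] → 0 < t → 0 ≤ c →
      1 ≤ t ^ 10 * c ^ 29 →
      t * contDen γ (n + 1) ≤ extendDen u (contDen γ n) (contDen γ (n + 1)) →
      (∀ δ ∈ S, (∀ k < n, δ k = γ k) → P δ → Follows δ n u) → Covered S (5 / 29 : ℝ) γ n P c :=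
    fun P u t c hu ht hc htc hden hP => covered_of_follows hS1 hγ hu hP ht hc hden htc
  by_cases hsame : ∀ δ ∈ S, (∀ k < n, δ k = γ k) → δ n = γ n
  · refine cover _ [γ n] 1 1 (by simp) one_pos zero_le_one (by norm_num) ?_
      fun δ hδ hag _ => ⟨hsame δ hδ hag, trivial⟩
    have := Nat.mul_le_mul (hdig γ hγ n).1 (le_refl (contDen γ (n + 1)))
    simp only [extendDen, one_mul]
    exact_mod_cast (by omega : contDen γ (n + 1) ≤ γ n * contDen γ (n + 1) + contDen γ n)
  push Not at hsame
  obtain ⟨α, β, hα, hαγ, hβ, hβγ, hlt⟩ : ∃ α β : ℕ → ℕ, α ∈ S ∧ (∀ k < n, α k = γ k) ∧ β ∈ S ∧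
      (∀ k < n, β k = γ k) ∧ α n < β n := by
    obtain ⟨δ, hδ, hδγ, hne⟩ := hsame
    rcases lt_or_gt_of_ne hne with h | h
    · exact ⟨δ, γ, hδ, hδγ, hγ, fun _ _ => rfl, h⟩
    · exact ⟨γ, δ, hγ, fun _ _ => rfl, hδ, hδγ, h⟩
  have hsucc := tails_succ_digit hq herr hα hβ hn (hcl hαγ hβγ) hlt
  have htwo : ∀ δ ∈ S, (∀ k < n, δ k = γ k) → δ n = α n ∨ δ n = β n := by
    intro δ hδ hδγ
    rcases lt_trichotomy (δ n) (α n) with h | h | h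
    · have := tails_succ_digit hq herr hδ hβ hn (hcl hδγ hβγ) (by omega)
      omega
    · exact Or.inl h
    · have := tails_succ_digit hq herr hα hδ hn (hcl hαγ hδγ) h
      omega
  have hα4 : α n = 1 ∨ α n = 2 ∨ α n = 3 := by
    have := (hdig α hα n).1
    have := (hdig β hβ n).2
    omega
  rcases hα4 with ha | ha | ha
  · have hb : β n = 2 := by omega
    refine ((cover (fun δ => δ n = 1) [1, 1, 3] (39 / 5) (493 / 1000) (by simp) (by norm_num)
      (by norm_num) (by norm_num) ?_ ?_).or (cover (fun δ => δ n = 2) [2, 3] (38 / 5) (4975 / 10000)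
      (by simp) (by norm_num) (by norm_num) (by norm_num) ?_ ?_)).mono ?_ (by norm_num)
    · simp only [extendDen]; push_cast; linarith
    · exact fun δ hδ hδγ h => (tails_one_two hq herr hδ hβ hn (hcl hδγ hβγ) h hb).1
    · simp only [extendDen]; push_cast; linarith
    · exact fun δ hδ hδγ h => (tails_one_two hq herr hα hδ hn (hcl hαγ hδγ) ha h).2
    · intro δ hδ hδγ _
      rw [← ha, ← hb]; exact htwo δ hδ hδγ
  · have hb : β n = 3 := by omega
    have h21 : ∀ δ ∈ S, (∀ k < n, δ k = γ k) → δ n = 2 → Follows δ n [2, 1, 3, 1] :=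
      fun δ hδ hδγ h => (tails_two_three hq herr hδ hβ hn (hcl hδγ hβγ) h hb).1
    have h3 : ∀ δ ∈ S, (∀ k < n, δ k = γ k) → δ n = 3 → δ (n + 1) = 3 ∨ δ (n + 1) = 4 := by
      intro δ hδ hδγ h
      have h1 := (tails_two_three hq herr hα hδ hn (hcl hαγ hδγ) ha h).2
      have h2 := (hdig δ hδ (n + 1)).2
      omega
    have hcases : ∀ δ ∈ S, (∀ k < n, δ k = γ k) → True →
        (δ n = 2 ∨ Follows δ n [3, 4]) ∨ Follows δ n [3, 3] := by
      intro δ hδ hδγ _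
      rcases htwo δ hδ hδγ with h | h
      · left; left; omega
      · rcases h3 δ hδ hδγ (by omega) with h' | h'
        · right; exact ⟨by omega, h', trivial⟩
        · left; right; exact ⟨by omega, h', trivial⟩
    by_cases h34 : ∃ η ∈ S, (∀ k < n, η k = γ k) ∧ Follows η n [3, 4]
    · obtain ⟨η, hη, hηγ, hη3, hη4, -⟩ := h34
      have h33 : ∀ δ ∈ S, (∀ k < n, δ k = γ k) → Follows δ n [3, 3] →
          Follows δ n [3, 3, 1, 3, 1] := by
        rintro δ hδ hδγ ⟨h1, h2, -⟩
        refine ⟨h1, tails_three_four hq herr hδ hη (by omega) (fun k hk => ?_) h2 hη4⟩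
        rcases Nat.lt_succ_iff_lt_or_eq.1 hk with hk | rfl
        · exact hcl hδγ hηγ k hk
        · omega
      by_cases hlast : γ (n - 1) = 1
      · have h11 : (6 : ℝ) * contDen γ (n + 1) ≤ 11 * contDen γ n := by
          exact_mod_cast contDen_of_last_one (hdig γ hγ) (by omega) hlast
        refine (((cover (fun δ => δ n = 2) [2, 1, 3, 1] (184 / 11) (379 / 1000) (by simp)
          (by norm_num) (by norm_num) (by norm_num) ?_ h21).or
          (cover (fun δ => Follows δ n [3, 4]) [3, 4] (167 / 11) (392 / 1000) (by simp)
          (by norm_num) (by norm_num) (by norm_num) ?_ fun _ _ _ h => h)).or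
          (cover (fun δ => Follows δ n [3, 3]) [3, 3, 1, 3, 1] (796 / 11) (229 / 1000) (by simp)
          (by norm_num) (by norm_num) (by norm_num) ?_ h33)).mono hcases (by norm_num)
        all_goals simp only [extendDen]; push_cast; linarith
      · have hlast2 : ∀ δ : ℕ → ℕ, (∀ k < n, δ k = γ k) → 2 ≤ δ (n - 1) := by
          intro δ hδγ
          rw [hδγ (n - 1) (by omega)]
          have := (hdig γ hγ (n - 1)).1
          omega
        refine (((cover (fun δ => δ n = 2) [2, 1, 3, 1, 3] (284 / 5) (25 / 100) (by simp)
          (by norm_num) (by norm_num) (by norm_num) ?_ fun δ hδ hδγ h =>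
            tails_two_three_four hq herr hδ hη hn (hcl hδγ hηγ) h hη3 hη4 (by omega)
              (hlast2 δ hδγ)).or
          (cover (fun δ => Follows δ n [3, 4]) [3, 4] (69 / 5) (41 / 100) (by simp)
          (by norm_num) (by norm_num) (by norm_num) ?_ fun _ _ _ h => h)).or
          (cover (fun δ => Follows δ n [3, 3]) [3, 3, 1, 3, 1] (329 / 5) (24 / 100) (by simp)
          (by norm_num) (by norm_num) (by norm_num) ?_ h33)).mono hcases (by norm_num)
        all_goals simp only [extendDen]; push_cast; linarith
    · push Not at h34
      refine ((cover (fun δ => δ n = 2) [2, 1, 3] (59 / 5) (43 / 100) (by simp)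
        (by norm_num) (by norm_num) (by norm_num) ?_ fun δ hδ hδγ h => ?_).or
        (cover (fun δ => Follows δ n [3, 3]) [3, 3] (53 / 5) (45 / 100) (by simp)
        (by norm_num) (by norm_num) (by norm_num) ?_ fun _ _ _ h => h)).mono ?_ (by norm_num)
      · simp only [extendDen]; push_cast; linarith
      · obtain ⟨k1, k2, k3, -⟩ := h21 δ hδ hδγ h
        exact ⟨k1, k2, k3, trivial⟩
      · simp only [extendDen]; push_cast; linarith
      · intro δ hδ hδγ _
        rcases hcases δ hδ hδγ trivial with (h | h) | h
        · exact Or.inl h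
        · exact absurd h (h34 δ hδ hδγ)
        · exact Or.inr h
  · have hb : β n = 4 := by omega
    refine ((cover (fun δ => δ n = 3) [3, 1, 3, 1] 20 (36 / 100) (by simp) (by norm_num)
      (by norm_num) (by norm_num) ?_ ?_).or (cover (fun δ => δ n = 4) [4] (21 / 5) (61 / 100)
      (by simp) (by norm_num) (by norm_num) (by norm_num) ?_ ?_)).mono ?_ (by norm_num)
    · simp only [extendDen]; push_cast; linarith
    · exact fun δ hδ hδγ h => tails_three_four hq herr hδ hβ hn (hcl hδγ hβγ) h hb
    · simp only [extendDen]; push_cast; linarith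
    · exact fun δ hδ hδγ h => ⟨h, trivial⟩
    · intro δ hδ hδγ _
      rw [← ha, ← hb]; exact htwo δ hδ hδγ

theorem dimH_isolatedTails_le (hq : 559 / 125 ≤ q) (herr : 2 / ((N : ℝ) + 1) ≤ ε) (hN : 3 ≤ N) :
    dimH (cfVal '' isolatedTails q ε N w) ≤ ((5 / 29 : NNReal) : ENNReal) := by
  refine dimH_image_cfVal_le (n₀ := N) (fun γ hγ k => (isolatedTails_digits hγ k).1) ?_ ?_
  · rintro γ ⟨a, -, haw, hγ⟩ δ ⟨a', -, haw', hδ⟩ k hk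
    have e : (((k + 1 + N : ℕ) : ℤ)) - N = k + 1 := by push_cast; ring
    have g := (haw ⟨k + 1 + N, by omega⟩).trans (haw' ⟨k + 1 + N, by omega⟩).symm
    simp only [e] at g
    rw [hγ, hδ]; exact g
  · intro γ hγ n hn
    simpa using covered_isolatedTails hq herr hN hγ hn

end tails

theorem Connects.mono {a : ℤ → ℕ} {n : ℤ} {c c' : ℝ} (h : Connects a n c) (hc : c ≤ c') :
    Connects a n c' := by
  obtain ⟨b, h1, h2, h3, h4⟩ := h
  exact ⟨b, h1, h2, h3, fun i => (h4 i).trans hc⟩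

/-- The countable union of the translated sets of values of isolated tails. -/
def exceptionalSet : Set ℝ :=
  ⋃ (d : ℕ) (q : ℚ) (k : ℕ) (N : ℕ) (w : Fin (2 * N + 1) → ℕ)
    (_ : (559 / 125 : ℝ) ≤ q ∧ 2 / ((N : ℝ) + 1) ≤ 1 / ((k : ℝ) + 1) ∧ 3 ≤ N),
    (fun x : ℝ => (d : ℝ) + x) '' (cfVal '' isolatedTails q (1 / ((k : ℝ) + 1)) N w)

theorem dimH_exceptionalSet_le : dimH exceptionalSet ≤ ((5 / 29 : NNReal) : ENNReal) := by
  unfold exceptionalSet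
  simp only [dimH_iUnion]
  refine iSup_le fun d => iSup_le fun q => iSup_le fun k => iSup_le fun N => iSup_le fun w =>
    iSup_le fun h => ?_
  rw [(isometry_add_left (d : ℝ)).dimH_image]
  exact dimH_isolatedTails_le h.1 h.2.1 h.2.2

theorem add_rightCF_mem_exceptionalSet {a : ℤ → ℕ} {m ε : ℝ} {N : ℕ} (hadm : Admissible a)
    (hm : 559 / 125 ≤ m) (hle : ∀ i, markovVal a i ≤ m) (hε : 0 < ε)
    (h : ∀ n : ℤ, N ≤ n → ¬ Connects a n (m + ε)) : a 0 + rightCF a 0 ∈ exceptionalSet := by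
  obtain ⟨k, hk⟩ := exists_nat_one_div_lt (half_pos hε)
  obtain ⟨q, hq1, hq2⟩ := exists_rat_btwn (show m < m + ε / 2 by linarith)
  obtain ⟨N', hN'⟩ := exists_two_div_lt (ε := 1 / ((k : ℝ) + 1)) (by positivity)
  set M := max N (max N' 3) with hM
  have hM1 : N ≤ M := le_max_left _ _
  have hM2 : N' ≤ M := (le_max_left _ _).trans (le_max_right _ _)
  have hM3 : 3 ≤ M := (le_max_right _ _).trans (le_max_right _ _)
  simp only [exceptionalSet, Set.mem_iUnion]
  refine ⟨a 0, q, k, M, fun j => a ((j : ℕ) - M), ⟨by linarith, (hN' M hM2).le, hM3⟩, _,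
    ⟨fun k : ℕ => a (k + 1), ⟨a, ⟨hadm, fun i => (hle i).trans hq1.le, fun n hn hc => ?_⟩,
      fun _ => rfl, fun _ => rfl⟩, rfl⟩, ?_⟩
  · exact h n (by omega) (hc.mono (by linarith))
  · simp only [rightCF]
    congr 2
    ext j
    exact congrArg a (by ring)

theorem rightCF_mem_cantorX4 {a : ℤ → ℕ} (h : Admissible a) (i : ℤ) : rightCF a i ∈ cantorX4 := by
  refine ⟨fun k : ℕ => a (i + 1 + k), fun k => ?_, fun k => ?_,
    hasContFracValue_cfVal fun k => (h _).1⟩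
  · have h1 := (h (i + 1 + k)).1
    have h2 := (h (i + 1 + k)).2.1
    simp only [Set.mem_insert_iff, Set.mem_singleton_iff]
    omega
  · have h1 := (h (i + 1 + k)).2.2
    have h2 := (h (i + 1 + (k + 1 : ℕ))).2.2
    have e : i + 1 + ((k + 1 : ℕ) : ℤ) = i + 1 + k + 1 := by push_cast; ring
    rw [e, add_sub_cancel_right] at h2
    simp only [Set.mem_insert_iff, Set.mem_singleton_iff, Prod.mk.injEq, e]
    omega

theorem propositionp :
    ∃ K : Set ℝ, dimH K < ENNReal.ofReal 0.172825 ∧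
      (markovSpectrum \ lagrangeSpectrum) ∩ Set.Ioo (Real.sqrt 20) (Real.sqrt 21) ⊆
        cantorX4 + K := by
  refine ⟨exceptionalSet, dimH_exceptionalSet_le.trans_lt ?_, ?_⟩
  · rw [ENNReal.ofReal, ENNReal.coe_lt_coe, Real.lt_toNNReal_iff_coe_lt]
    push_cast
    norm_num
  · rintro m ⟨⟨hM, hL⟩, hm1, hm2⟩
    have hlo : (559 / 125 : ℝ) < m := lt_of_le_of_lt (Real.le_sqrt_of_sq_le (by norm_num)) hm1
    have hhi : m < 229129 / 50000 := lt_of_lt_of_le hm2 (Real.sqrt_le_iff.2 (by norm_num))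
    obtain ⟨a, ha, ha0, hle⟩ := exists_sequence_of_mem_markovSpectrum hM (by linarith)
    have hadm := admissible_of_markovVal_le ha hhi hle
    by_cases hr : ∀ ε > 0, ∀ N : ℕ, ∃ n : ℤ, N ≤ n ∧ Connects a n (m + ε)
    · by_cases hl : ∀ ε > 0, ∀ N : ℕ, ∃ n : ℤ, N ≤ n ∧ Connects (fun i => a (-i)) n (m + ε)
      · exact absurd (mem_lagrangeSpectrum_of_connects ha (by linarith) (by linarith) ha0 hr hl) hL
      · push Not at hl
        obtain ⟨ε, hε, N, hN⟩ := hl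
        have h1 := add_rightCF_mem_exceptionalSet hadm.rev hlo.le
          (fun i => by rw [markovVal_rev]; exact hle _) hε hN
        simp only [rightCF_rev, neg_zero] at h1
        refine ⟨_, rightCF_mem_cantorX4 hadm 0, _, h1, ?_⟩
        simp only
        rw [← ha0, markovVal]; ring
    · push Not at hr
      obtain ⟨ε, hε, N, hN⟩ := hr
      have h1 := add_rightCF_mem_exceptionalSet hadm hlo.le hle hε hN
      have h2 := rightCF_mem_cantorX4 hadm.rev 0
      rw [rightCF_rev, neg_zero] at h2
      refine ⟨_, h2, _, h1, ?_⟩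
      simp only
      rw [← ha0, markovVal]; ring
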